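/- Let $0\le q<p$. For $\theta=(\Lambda,\psi)$ with $\Lambda\in\mathbb R^{p\times q}$, $\psi\in\mathbb R^p$, put $\Lambda(\theta)=\Lambda$, $\Psi(\theta)=\operatorname{diag}(\psi)$ and $\Sigma(\theta)=\Lambda\Lambda^\top+\Psi(\theta)$, and let $\Theta=\{\theta:\psi_1,\dots,\psi_p>0\}$. Write $\|C\|=\max_{i,j}|C_{ij}|$. For each $n$ let $x_{1},\dots,x_{n}$ be random vectors in $\mathbb R^p$ (they may form a triangular array; no independence is needed), with sample covariance matrix $S=S_n=\frac1n\sum_{i=1}^n(x_i-\bar x)(x_i-\bar x)^\top$. The log-likelihood is $$\ell(\theta;S)=-\tfrac{np}{2}\log(2\pi)-\tfrac n2\bigl[\log\det\Sigma(\theta)+\operatorname{tr}\{\Sigma(\theta)^{-1}S\}\bigr].$$ Let $P^*=P^*_n:\Theta\to\mathbb R$ be penalty functions, which may depend on $n$ and be random. A maximum likelihood (ML) estimate is a maximiser of $\ell(\theta;S)$ over $\Theta$, and a maximum penalised likelihood (MPL) estimate is a maximiser of $\ell(\theta;S)+P^*(\theta)$ over $\Theta$. Suppose that * (N1) there is an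 interior point $\theta_0\in\Theta$ with $S_n\to\Sigma(\theta_0)$ in probability; write $\Lambda_0,\Psi_0,\Sigma_0$ for $\Lambda(\theta_0),\Psi(\theta_0),\Sigma(\theta_0)$; * (N2) the factor model is strongly identifiable: for every $\epsilon>0$ there is $\delta>0$ such that for every $\theta\in\Theta$ with $\|\Sigma_0-\Sigma(\theta)\|<\delta$ there is an orthogonal $q\times q$ matrix $Q$ with $\|\Lambda_0-\Lambda(\theta)Q\|<\epsilon$ and $\|\Psi_0-\Psi(\theta)\|<\epsilon$; and the Jacobian of $\operatorname{vec}\Sigma(\theta)$ at $\theta_0$ is nonsingular modulo rotations, that is, every vector in its kernel is of the form $(\Lambda_0A,0)$ with $A$ skew-symmetric (for $q\le1$: its kernel is trivial); * (N3) with $F(\Sigma_1,\Sigma_2)=\log\det\Sigma_2+\operatorname{tr}(\Sigma_2^{-1}\Sigma_1)-p-\log\det\Sigma_1$, for every $\epsilon>0$ there is $\delta>0$ such that, for all positive definite $S$ and all $\theta\in\Theta$, $\|S-\Sigma_0\|<\delta$ and $F(S,\Sigma(\theta))<\delta$ imply $\|\Sigma(\theta)-\Sigma_0\|<\epsilon$;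 * (N4) with probability tending to one, the set of MPL estimates is non-empty; * (N5) $P^*\le 0$ on $\Theta$; $P^*$ is continuously differentiable on $\Theta$ and invariant under orthogonal rotations, $P^*(\Lambda Q,\psi)=P^*(\Lambda,\psi)$; and $P^*$ is $o_p(\sqrt n)$ as a continuously differentiable function: $P^*(\theta)=o_p(\sqrt n)$ for every $\theta\in\Theta$, and $\sup_{\theta\in U}\|\nabla P^*(\theta)\|=o_p(\sqrt n)$ for some neighbourhood $U$ of $\theta_0$. (If $P^*=c_nP$ with scalars $c_n$ and a fixed continuously differentiable function $P$, the gradient condition follows from $P^*(\theta)=o_p(\sqrt n)$ for every $\theta\in\Theta$.) Let $\tilde\theta$ and $\hat\theta$ be measurable selections: $\tilde\theta$ is an MPL estimate whenever one exists, and $\hat\theta$ is an ML estimate whenever one exists. Then there are sequences $Q_1,Q_2$ of random orthogonal $q\times q$ matrices such that, in probability as $n\to\infty$, $$\|\Lambda(\tilde\theta)Q_1-\Lambda_0\|\to0,\qquad \|\Psi(\tilde\theta)-\Psi_0\|\to0,$$ $$\sqrt n\,\|\Lambda(\tilde\theta)Q_1-\Lambda(\hat\theta)Q_2\|\to0,\qquad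 \sqrt n\,\|\Psi(\tilde\theta)-\Psi(\hat\theta)\|\to0 .$$ Consequently the MPL estimator shares the asymptotic distribution of the ML estimator: for every sequence $R$ of random orthogonal matrices and every probability law $\nu$ (for instance a normal law), if $\sqrt n\,\bigl((\Lambda(\hat\theta)Q_2R,\hat\psi)-\theta_0\bigr)$ converges in distribution to $\nu$, then so does $\sqrt n\,\bigl((\Lambda(\tilde\theta)Q_1R,\tilde\psi)-\theta_0\bigr)$. -/

import Mathlib

open Filter MeasureTheory
open scoped Topology

/- Matrices carry the entrywise maximum norm `‖C‖ = max |C i j|`. -/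
attribute [local instance] Matrix.normedAddCommGroup

namespace FactorAnalysis

/-- A parameter vector `θ = (Λ, ψ)`: the `p × q` loadings and the `p` error variances. -/
abbrev Param (p q : ℕ) : Type := (Fin p → Fin q → ℝ) × (Fin p → ℝ)

variable {p q : ℕ}

/-- The loading matrix `Λ(θ)`. -/
def loadings (θ : Param p q) : Matrix (Fin p) (Fin q) ℝ := Matrix.of θ.1

/-- The diagonal error covariance matrix `Ψ(θ)`. -/
def errorCov (θ : Param p q) : Matrix (Fin p) (Fin p) ℝ := Matrix.diagonal θ.2

/-- The parameter space `Θ`: all error variances are positive. -/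
def paramSpace (p q : ℕ) : Set (Param p q) := {θ | ∀ j, 0 < θ.2 j}

/-- The model covariance matrix `Σ(θ) = Λ(θ) Λ(θ)ᵀ + Ψ(θ)`. -/
def modelCov (θ : Param p q) : Matrix (Fin p) (Fin p) ℝ :=
  loadings θ * (loadings θ).transpose + errorCov θ

/-- The parameter `(Λ Q, ψ)`. -/
def rotate (θ : Param p q) (Q : Matrix (Fin q) (Fin q) ℝ) : Param p q :=
  (fun i k => (loadings θ * Q) i k, θ.2)

/-- The sample mean of `n` observations. -/
noncomputable def sampleMean {n : ℕ} (x : Fin n → Fin p → ℝ) : Fin p → ℝ :=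
  (n : ℝ)⁻¹ • ∑ i, x i

/-- The sample covariance matrix `S = n⁻¹ ∑ (xᵢ - x̄)(xᵢ - x̄)ᵀ` of `n` observations. -/
noncomputable def sampleCov {n : ℕ} (x : Fin n → Fin p → ℝ) : Matrix (Fin p) (Fin p) ℝ :=
  (n : ℝ)⁻¹ • ∑ i, Matrix.vecMulVec (x i - sampleMean x) (x i - sampleMean x)

/-- The profile log-likelihood
`ℓ(θ; S) = -(n p / 2) log (2π) - (n / 2) (log det Σ(θ) + tr (Σ(θ)⁻¹ S))`. -/
noncomputable def logLik (n : ℕ) (S : Matrix (Fin p) (Fin p) ℝ) (θ : Param p q) : ℝ :=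
  -((n : ℝ) * p * Real.log (2 * Real.pi) / 2)
    - (n : ℝ) / 2 * (Real.log (modelCov θ).det + ((modelCov θ)⁻¹ * S).trace)

/-- The maximum likelihood estimates: the maximisers of `ℓ(θ; S)` over `Θ`. -/
def mlEstimates (n : ℕ) (S : Matrix (Fin p) (Fin p) ℝ) : Set (Param p q) :=
  {θ | θ ∈ paramSpace p q ∧ IsMaxOn (fun t => logLik n S t) (paramSpace p q) θ}

/-- The maximum penalised likelihood estimates: the maximisers of `ℓ(θ; S) + P(θ)` over `Θ`. -/
def mplEstimates (n : ℕ) (S : Matrix (Fin p) (Fin p) ℝ) (P : Param p q → ℝ) :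
    Set (Param p q) :=
  {θ | θ ∈ paramSpace p q ∧ IsMaxOn (fun t => logLik n S t + P t) (paramSpace p q) θ}

/-- Strong identifiability of the factor model at `θ₀`: if `Σ(θ)` is close to `Σ(θ₀)`, then
`Λ(θ)`, after an orthogonal rotation, and `Ψ(θ)` are close to `Λ(θ₀)` and `Ψ(θ₀)`. -/
def StronglyIdentifiable (θ₀ : Param p q) : Prop :=
  ∀ ε : ℝ, 0 < ε → ∃ δ : ℝ, 0 < δ ∧ ∀ θ ∈ paramSpace p q,
    ‖modelCov θ₀ - modelCov θ‖ < δ →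
      ∃ Q ∈ Matrix.orthogonalGroup (Fin q) ℝ,
        ‖loadings θ₀ - loadings θ * Q‖ < ε ∧ ‖errorCov θ₀ - errorCov θ‖ < ε

/-- The Jacobian of `θ ↦ vec Σ(θ)` at `θ₀` is nonsingular modulo rotations of the factors: it
annihilates at most the directions `(Λ₀ A, 0)` with `A` skew-symmetric, the tangent directions of
the orbit `{(Λ₀ Q, ψ₀) : Q orthogonal}` on which `Σ` is constant. For `q ≤ 1` this says that the
Jacobian has trivial kernel. -/
def JacobianNonsingular (θ₀ : Param p q) : Prop :=
  ∀ h : Param p q, fderiv ℝ (fun (θ : Param p q) (i j : Fin p) => modelCov θ i j) θ₀ h = 0 →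
    ∃ A : Matrix (Fin q) (Fin q) ℝ, A.transpose = -A ∧
      h = (fun i k => (loadings θ₀ * A) i k, 0)

/-- The discrepancy function
`F(Σ₁, Σ₂) = log det Σ₂ + tr (Σ₂⁻¹ Σ₁) - p - log det Σ₁`. -/
noncomputable def discrepancy (S₁ S₂ : Matrix (Fin p) (Fin p) ℝ) : ℝ :=
  Real.log S₂.det + (S₂⁻¹ * S₁).trace - p - Real.log S₁.det

/-- Kano's condition on the discrepancy function at `Σ₀ = Σ(θ₀)`. -/
def KanoCondition (θ₀ : Param p q) : Prop :=
  ∀ ε : ℝ, 0 < ε → ∃ δ : ℝ, 0 < δ ∧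
    ∀ S : Matrix (Fin p) (Fin p) ℝ, S.PosDef → ∀ θ ∈ paramSpace p q,
      ‖S - modelCov θ₀‖ < δ → discrepancy S (modelCov θ) < δ →
        ‖modelCov θ - modelCov θ₀‖ < ε

/-- The conditions on the penalties `P n ω : Θ → ℝ` (`n` the sample size, `ω` the outcome):
nonpositive, continuously differentiable on `Θ`, invariant under orthogonal rotations of the
loadings, and of order `o_p(√n)` as continuously differentiable functions, that is, pointwise in
value and, near `θ₀`, uniformly in the first derivative. For `P n ω = c n ω • P₁` with a
fixed continuously differentiable `P₁`, the pointwise order implies the order of the derivative. -/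
structure SoftPenalty {Ω : Type*} [MeasurableSpace Ω] (μ : Measure Ω) (θ₀ : Param p q)
    (P : ℕ → Ω → Param p q → ℝ) : Prop where
  nonpos : ∀ n ω, ∀ θ ∈ paramSpace p q, P n ω θ ≤ 0
  contDiffOn : ∀ n ω, ContDiffOn ℝ 1 (P n ω) (paramSpace p q)
  rotate_eq : ∀ n ω, ∀ θ ∈ paramSpace p q, ∀ Q ∈ Matrix.orthogonalGroup (Fin q) ℝ,
    P n ω (rotate θ Q) = P n ω θ
  order : ∀ θ ∈ paramSpace p q,
    TendstoInMeasure μ (fun n ω => P n ω θ / Real.sqrt n) atTop (fun _ => (0 : ℝ))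
  order_deriv : ∃ U ∈ 𝓝 θ₀, ∀ ε : ℝ, 0 < ε →
    Tendsto (fun n : ℕ => μ {ω | ∃ θ ∈ U, ε * Real.sqrt n < ‖fderiv ℝ (P n ω) θ‖})
      atTop (𝓝 0)

/-- The entries of a random matrix are measurable. -/
def MeasurableEntries {Ω : Type*} [MeasurableSpace Ω] {m k : ℕ}
    (M : Ω → Matrix (Fin m) (Fin k) ℝ) : Prop :=
  ∀ i j, Measurable fun ω => M ω i j

/-- The centred and scaled estimator `√n (θ - θ₀)`. -/
noncomputable def scaledError (n : ℕ) (θ₀ θ : Param p q) : Param p q :=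
  Real.sqrt n • (θ - θ₀)

end FactorAnalysis

/-! Up to constants the negative log-likelihood is n/2 times f(θ) = log det Σ(θ) + tr(Σ(θ)⁻¹S), so a
penalised estimate minimises f up to (2/n) times a penalty difference. Comparing it with θ₀ and
using P ≤ 0 shows that its discrepancy is small. Kano's condition and strong identifiability then
put it near θ₀ after a rotation (`exists_aligned`); the same comparison on a compact ball gives
existence of ML estimates when S is near Σ₀.

For the rate, the rotation freedom is removed by Procrustes alignment (`exists_procrustes`): the
chosen rotation makes Λ₀ᵀΛ symmetric. This is a linear condition, so differences of aligned
parameters satisfy it too, and on it the Jacobian of Σ is injective (`eq_zero_of_covDeriv_eq_zero`).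
Hence the gradient of f is strongly monotone between aligned points near θ₀ (`curvature_eq`,
`exists_curvature_ge`). At the ML estimate a the slope towards the penalised estimate b is
nonnegative; at b the slope towards a is at least -(2K/n)‖b - a‖, where K bounds the penalty
gradient. Adding the two gives c‖b - a‖² ≤ (2K/n)‖b - a‖ (`exists_norm_sub_le`), and K = o_p(√n)
yields √n‖b - a‖ → 0.

These rotations are found outcome by outcome. Measurable ones are selected from a countable dense
set at a cost of 1/(n+1), which is o(n^(-1/2)). The limit law then transfers by Slutsky's lemma. -/

namespace FactorAnalysis

/-! ### Orthogonal matrices, Procrustes alignment and positive definite matrices. -/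

section LinearAlgebra

open Matrix

attribute [local instance] Matrix.normedSpace

instance matrixProperSpace (m n : ℕ) : ProperSpace (Matrix (Fin m) (Fin n) ℝ) :=
  inferInstanceAs (ProperSpace (Fin m → Fin n → ℝ))

instance matrixSecondCountable (m n : ℕ) :
    SecondCountableTopology (Matrix (Fin m) (Fin n) ℝ) :=
  inferInstanceAs (SecondCountableTopology (Fin m → Fin n → ℝ))

theorem norm_le_one_of_mem_orthogonalGroup {q : ℕ} {Q : Matrix (Fin q) (Fin q) ℝ}
    (hQ : Q ∈ orthogonalGroup (Fin q) ℝ) : ‖Q‖ ≤ 1 :=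
  (Matrix.norm_le_iff zero_le_one).2 fun i j => entry_norm_bound_of_unitary hQ i j

theorem isClosed_orthogonalGroup (q : ℕ) :
    IsClosed {Q : Matrix (Fin q) (Fin q) ℝ | Q ∈ orthogonalGroup (Fin q) ℝ} := by
  simp only [mem_orthogonalGroup_iff]
  exact isClosed_eq (by fun_prop) continuous_const

theorem isCompact_orthogonalGroup (q : ℕ) :
    IsCompact {Q : Matrix (Fin q) (Fin q) ℝ | Q ∈ orthogonalGroup (Fin q) ℝ} := by
  refine Metric.isCompact_of_isClosed_isBounded (isClosed_orthogonalGroup q)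
    ((Metric.isBounded_closedBall (x := 0) (r := 1)).subset fun Q hQ => ?_)
  simpa using norm_le_one_of_mem_orthogonalGroup hQ

theorem norm_mul_le {m k n : ℕ} (A : Matrix (Fin m) (Fin k) ℝ) (B : Matrix (Fin k) (Fin n) ℝ) :
    ‖A * B‖ ≤ k * (‖A‖ * ‖B‖) := by
  refine (Matrix.norm_le_iff (by positivity)).2 fun i j => ?_
  rw [Matrix.mul_apply]
  refine (norm_sum_le _ _).trans ?_
  calc ∑ l, ‖A i l * B l j‖ ≤ ∑ _l : Fin k, ‖A‖ * ‖B‖ := by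
        refine Finset.sum_le_sum fun l _ => ?_
        rw [norm_mul]
        gcongr
        · exact Matrix.norm_entry_le_entrywise_sup_norm A
        · exact Matrix.norm_entry_le_entrywise_sup_norm B
    _ = _ := by simp

/-- The maximum norm is not rotation invariant; the factor `q` is the price of a rotation and is
absorbed into the tolerances later. -/
theorem norm_mul_orthogonal_le {m q : ℕ} (A : Matrix (Fin m) (Fin q) ℝ)
    {Q : Matrix (Fin q) (Fin q) ℝ} (hQ : Q ∈ orthogonalGroup (Fin q) ℝ) :
    ‖A * Q‖ ≤ q * ‖A‖ := by
  refine (norm_mul_le A Q).trans ?_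
  have := norm_le_one_of_mem_orthogonalGroup hQ
  have h := mul_le_of_le_one_right (norm_nonneg A) this
  gcongr

/-- A rotation by the angle with tangent half-angle `t` in a coordinate plane. -/
theorem add_smul_add_smul_mem_orthogonalGroup {q : ℕ} {A : Matrix (Fin q) (Fin q) ℝ}
    (hA : Aᵀ = -A) (hA3 : A * (A * A) = -A) (t : ℝ) :
    1 + (2 * t / (1 + t ^ 2)) • A + (2 * t ^ 2 / (1 + t ^ 2)) • (A * A) ∈
      orthogonalGroup (Fin q) ℝ := by
  have h0 : (1 + t ^ 2) ≠ 0 := by positivity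
  rw [mem_orthogonalGroup_iff]
  simp only [transpose_add, transpose_one, transpose_smul, transpose_mul, hA, neg_mul_neg]
  set s := 2 * t / (1 + t ^ 2) with hs
  set c := 2 * t ^ 2 / (1 + t ^ 2) with hc
  -- This is sin² + cos² = 1, with `s` the sine and `1 - c` the cosine.
  have hsc : 2 * c - s ^ 2 - c ^ 2 = 0 := by
    rw [hs, hc]; field_simp; ring
  have key : (1 + s • A + c • (A * A)) * (1 + s • -A + c • (A * A)) =
      1 + (2 * c - s ^ 2 - c ^ 2) • (A * A) := by
    simp only [add_mul, mul_add, one_mul, mul_one, smul_mul_assoc, mul_smul_comm, smul_neg,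
      mul_neg, Matrix.mul_assoc, hA3]
    module
  rw [key, hsc, zero_smul, add_zero]

/-- At a maximiser of `tr (M Q)` over the orthogonal group (taken to be `Q = 1`), `M` is
symmetric. -/
theorem isSymm_of_trace_mul_le {q : ℕ} {M : Matrix (Fin q) (Fin q) ℝ}
    (hM : ∀ Q ∈ orthogonalGroup (Fin q) ℝ, (M * Q).trace ≤ M.trace) : M.IsSymm := by
  have key : ∀ A : Matrix (Fin q) (Fin q) ℝ, Aᵀ = -A → A * (A * A) = -A →
      (M * A).trace ≤ 0 := by
    intro A hA hA3
    -- The first-order condition: the trace inequality for the rotation with parameter `t` is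
    -- divided by 2t/(1+t²) > 0, and then `t` tends to 0.
    have h1 : ∀ t : ℝ, 0 < t → (M * A).trace + t * (M * (A * A)).trace ≤ 0 := by
      intro t ht
      have h0 : 0 < 1 + t ^ 2 := by positivity
      have h2 := hM _ (add_smul_add_smul_mem_orthogonalGroup hA hA3 t)
      simp only [mul_add, mul_one, trace_add, mul_smul_comm, trace_smul, smul_eq_mul] at h2
      have h3 : (2 * t / (1 + t ^ 2)) * ((M * A).trace + t * (M * (A * A)).trace) ≤ 0 := by
        have : (2 * t / (1 + t ^ 2)) * ((M * A).trace + t * (M * (A * A)).trace) =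
          2 * t / (1 + t ^ 2) * (M * A).trace + 2 * t ^ 2 / (1 + t ^ 2) * (M * (A * A)).trace := by
          ring
        linarith
      exact nonpos_of_mul_nonpos_right h3 (by positivity)
    have h4 : Tendsto (fun t : ℝ => (M * A).trace + t * (M * (A * A)).trace) (𝓝[>] 0)
        (𝓝 ((M * A).trace + 0 * (M * (A * A)).trace)) :=
      tendsto_nhdsWithin_of_tendsto_nhds
        (Continuous.tendsto (by fun_prop) (0 : ℝ))
    have h5 := le_of_tendsto h4 (eventually_mem_nhdsWithin.mono fun t ht => h1 t ht)
    simpa using h5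
  ext i j
  rw [transpose_apply]
  by_cases hij : i = j
  · rw [hij]
  have hji : j ≠ i := fun h => hij h.symm
  have h : ∀ a b : Fin q, a ≠ b → M b a ≤ M a b := by
    intro a b hab
    -- The generator of rotations in the plane of `a` and `b` isolates one off-diagonal pair;
    -- exchanging the indices gives the reverse inequality.
    have h6 := key (Matrix.single a b 1 - Matrix.single b a 1) (by simp [transpose_single]) (by
      simp [mul_sub, sub_mul, hab, hab.symm, neg_add_eq_sub])
    simp [mul_sub, trace_sub, trace_mul_single] at h6
    linarith
  exact le_antisymm (h i j hij) (h j i hji)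

theorem trace_transpose_mul_self_sub_mul {p q : ℕ} (L L₀ : Matrix (Fin p) (Fin q) ℝ)
    {Q : Matrix (Fin q) (Fin q) ℝ} (hQ : Q ∈ orthogonalGroup (Fin q) ℝ) :
    ((L * Q - L₀)ᵀ * (L * Q - L₀)).trace =
      (Lᵀ * L).trace + (L₀ᵀ * L₀).trace - 2 * (L₀ᵀ * L * Q).trace := by
  have hQ' : Q * Qᵀ = 1 := by
    simpa [star_eq_conjTranspose] using (mem_orthogonalGroup_iff (Fin q) ℝ).1 hQ
  have h1 : ((L * Q)ᵀ * (L * Q)).trace = (Lᵀ * L).trace := by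
    rw [transpose_mul, Matrix.mul_assoc, trace_mul_comm, Matrix.mul_assoc, Matrix.mul_assoc, hQ',
      Matrix.mul_one]
  have h2 : ((L * Q)ᵀ * L₀).trace = (L₀ᵀ * L * Q).trace := by
    rw [← trace_transpose, transpose_mul, transpose_transpose, Matrix.mul_assoc]
  simp only [transpose_sub, Matrix.sub_mul, Matrix.mul_sub, trace_sub]
  rw [h1, h2, ← Matrix.mul_assoc]
  ring

theorem trace_transpose_mul_self_eq {p q : ℕ} (X : Matrix (Fin p) (Fin q) ℝ) :
    (Xᵀ * X).trace = ∑ j, ∑ i, X i j ^ 2 := by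
  simp [Matrix.trace, Matrix.mul_apply, sq]

theorem norm_le_sqrt_trace {p q : ℕ} (X : Matrix (Fin p) (Fin q) ℝ) :
    ‖X‖ ≤ Real.sqrt (Xᵀ * X).trace := by
  refine (Matrix.norm_le_iff (Real.sqrt_nonneg _)).2 fun i j => ?_
  rw [Real.norm_eq_abs, trace_transpose_mul_self_eq]
  refine Real.abs_le_sqrt ?_
  calc X i j ^ 2 ≤ ∑ i, X i j ^ 2 :=
        Finset.single_le_sum (f := fun i => X i j ^ 2) (fun _ _ => sq_nonneg _) (Finset.mem_univ i)
    _ ≤ _ := Finset.single_le_sum (f := fun j => ∑ i, X i j ^ 2)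
        (fun _ _ => Finset.sum_nonneg fun _ _ => sq_nonneg _) (Finset.mem_univ j)

theorem trace_le_mul_norm_sq {p q : ℕ} (X : Matrix (Fin p) (Fin q) ℝ) :
    (Xᵀ * X).trace ≤ q * p * ‖X‖ ^ 2 := by
  rw [trace_transpose_mul_self_eq]
  calc ∑ j, ∑ i, X i j ^ 2 ≤ ∑ _j : Fin q, ∑ _i : Fin p, ‖X‖ ^ 2 := by
        refine Finset.sum_le_sum fun j _ => Finset.sum_le_sum fun i _ => ?_
        rw [← sq_abs, ← Real.norm_eq_abs]
        gcongr
        exact Matrix.norm_entry_le_entrywise_sup_norm X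
    _ = _ := by simp; ring

/-- Orthogonal Procrustes alignment of `L` with `L₀`. -/
theorem exists_procrustes {p q : ℕ} (L L₀ : Matrix (Fin p) (Fin q) ℝ) :
    ∃ Q ∈ orthogonalGroup (Fin q) ℝ, (L₀ᵀ * (L * Q)).IsSymm ∧
      ∀ Q' ∈ orthogonalGroup (Fin q) ℝ, ‖L * Q - L₀‖ ≤ Real.sqrt (q * p) * ‖L * Q' - L₀‖ := by
  -- Maximising this trace minimises the Frobenius distance from `L * Q` to `L₀`. The factor √(qp)
  -- comes from comparing the Frobenius and maximum norms.
  obtain ⟨Q, hQ, hmax⟩ := (isCompact_orthogonalGroup q).exists_isMaxOn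
    ⟨1, one_mem (orthogonalGroup (Fin q) ℝ)⟩
    (f := fun Q => (L₀ᵀ * L * Q).trace) (by fun_prop)
  refine ⟨Q, hQ, ?_, fun Q' hQ' => ?_⟩
  · rw [← Matrix.mul_assoc]
    refine isSymm_of_trace_mul_le fun R hR => ?_
    rw [Matrix.mul_assoc]
    exact hmax ((orthogonalGroup (Fin q) ℝ).mul_mem hQ hR)
  · have h1 : (L₀ᵀ * L * Q').trace ≤ (L₀ᵀ * L * Q).trace := hmax hQ'
    refine (norm_le_sqrt_trace _).trans ?_
    rw [Real.sqrt_le_left (by positivity), mul_pow, Real.sq_sqrt (by positivity)]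
    refine le_trans ?_ (trace_le_mul_norm_sq _)
    rw [trace_transpose_mul_self_sub_mul _ _ hQ, trace_transpose_mul_self_sub_mul _ _ hQ']
    linarith

/-- Sum log x ≤ x - 1 over the eigenvalues. -/
theorem log_det_le_trace_sub {p : ℕ} {M : Matrix (Fin p) (Fin p) ℝ} (hM : M.PosDef) :
    Real.log M.det ≤ M.trace - p := by
  have hd : M.det = ∏ i, hM.1.eigenvalues i := by
    simpa using hM.1.det_eq_prod_eigenvalues
  have ht : M.trace = ∑ i, hM.1.eigenvalues i := by
    simpa using hM.1.trace_eq_sum_eigenvalues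
  rw [hd, ht, Real.log_prod fun i _ => (hM.eigenvalues_pos i).ne']
  calc ∑ i, Real.log (hM.1.eigenvalues i) ≤ ∑ i, (hM.1.eigenvalues i - 1) :=
        Finset.sum_le_sum fun i _ => Real.log_le_sub_one_of_pos (hM.eigenvalues_pos i)
    _ = _ := by simp

open scoped MatrixOrder Matrix.Norms.L2Operator in
theorem exists_transpose_mul_self_of_posDef {p : ℕ} {M : Matrix (Fin p) (Fin p) ℝ}
    (hM : M.PosDef) : ∃ B : Matrix (Fin p) (Fin p) ℝ, M = Bᵀ * B := by
  obtain ⟨B, hB⟩ := CStarAlgebra.nonneg_iff_eq_star_mul_self.mp hM.posSemidef.nonneg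
  exact ⟨B, by simpa [star_eq_conjTranspose] using hB⟩

/-- Concavity of the log-determinant, as a supergradient inequality. -/
theorem log_det_sub_log_det_le {p : ℕ} {σ τ : Matrix (Fin p) (Fin p) ℝ} (hσ : σ.PosDef)
    (hτ : τ.PosDef) : Real.log τ.det - Real.log σ.det ≤ (σ⁻¹ * (τ - σ)).trace := by
  obtain ⟨B, hB⟩ := exists_transpose_mul_self_of_posDef hσ.inv
  have hσu : IsUnit σ.det := hσ.det_pos.ne'.isUnit
  have hdet : σ.det⁻¹ = B.det * B.det := by
    rw [← Ring.inverse_eq_inv', ← Matrix.det_nonsing_inv, hB, Matrix.det_mul, det_transpose]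
  have hBu : IsUnit B.det := by
    rw [isUnit_iff_ne_zero]
    intro h
    rw [h, mul_zero, inv_eq_zero] at hdet
    exact hσ.det_pos.ne' hdet
  -- The product σ⁻¹τ need not be symmetric; this congruence of τ is positive definite and has the
  -- same determinant and trace.
  have hM : (B * τ * Bᵀ).PosDef := by
    have := hτ.mul_mul_conjTranspose_same (B := B)
      (Matrix.vecMul_injective_of_isUnit ((Matrix.isUnit_iff_isUnit_det B).2 hBu))
    simpa using this
  have h := log_det_le_trace_sub hM
  have h1 : (B * τ * Bᵀ).det = τ.det * σ.det⁻¹ := by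
    rw [Matrix.det_mul, Matrix.det_mul, Matrix.det_transpose, hdet]; ring
  have h2 : (B * τ * Bᵀ).trace = (σ⁻¹ * τ).trace := by
    rw [Matrix.trace_mul_comm, ← Matrix.mul_assoc, ← hB]
  rw [h1, h2, Real.log_mul hτ.det_pos.ne' (inv_ne_zero hσ.det_pos.ne'), Real.log_inv] at h
  rw [Matrix.mul_sub, Matrix.nonsing_inv_mul _ hσu, trace_sub, trace_one, Fintype.card_fin]
  linarith

/-- Writing W = BᵀB with B invertible, the trace is the squared Frobenius norm of BDBᵀ. This is the
source of positive curvature at θ₀. -/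
theorem trace_mul_mul_mul_pos {p : ℕ} {W D : Matrix (Fin p) (Fin p) ℝ} (hW : W.PosDef)
    (hD : Dᵀ = D) (hD0 : D ≠ 0) : 0 < (W * D * W * D).trace := by
  obtain ⟨B, hB⟩ := exists_transpose_mul_self_of_posDef hW
  have h1 : (W * D * W * D).trace = ((B * D * Bᵀ)ᵀ * (B * D * Bᵀ)).trace := by
    simp only [transpose_mul, transpose_transpose, hD]
    rw [hB, Matrix.trace_mul_comm (Bᵀ * B * D * (Bᵀ * B)) D]
    simp only [Matrix.mul_assoc]
    rw [Matrix.trace_mul_comm B]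
    simp only [Matrix.mul_assoc]
  have hBu : IsUnit B := by
    rw [Matrix.isUnit_iff_isUnit_det, isUnit_iff_ne_zero]
    intro h
    have := hW.det_pos
    rw [hB, Matrix.det_mul, h, mul_zero] at this
    exact lt_irrefl _ this
  have h2 : B * D * Bᵀ ≠ 0 := by
    intro h
    have hBt : IsUnit Bᵀ := by
      rw [Matrix.isUnit_iff_isUnit_det, det_transpose]
      exact (Matrix.isUnit_iff_isUnit_det _).1 hBu
    rw [hBt.mul_left_eq_zero, hBu.mul_right_eq_zero] at h
    exact hD0 h
  rw [h1]
  have h3 : (B * D * Bᵀ)ᵀ = (B * D * Bᵀ)ᴴ := by simp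
  have h4 : ((B * D * Bᵀ)ᵀ * (B * D * Bᵀ)).trace ≠ 0 := by
    rw [h3, Ne, trace_conjTranspose_mul_self_eq_zero_iff]
    exact h2
  refine lt_of_le_of_ne ?_ h4.symm
  rw [trace_transpose_mul_self_eq]
  positivity

theorem continuousAt_inv_of_posDef {p : ℕ} {σ : Matrix (Fin p) (Fin p) ℝ} (hσ : σ.PosDef) :
    ContinuousAt (fun τ : Matrix (Fin p) (Fin p) ℝ => τ⁻¹) σ := by
  refine continuousAt_matrix_inv σ ?_
  rw [Ring.inverse_eq_inv']
  exact continuousAt_inv₀ hσ.det_pos.ne'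

/-- Symmetric matrices close to a positive definite one are positive definite. -/
theorem eventually_posDef {p : ℕ} {σ : Matrix (Fin p) (Fin p) ℝ} (hσ : σ.PosDef) :
    ∀ᶠ S in 𝓝 σ, S.IsHermitian → S.PosDef := by
  have hK : IsCompact (Metric.sphere (0 : Fin p → ℝ) 1) := isCompact_sphere _ _
  -- Compactness of the unit sphere gives one neighbourhood of σ that serves all directions.
  have h1 : ∀ᶠ S in 𝓝 σ, ∀ v ∈ Metric.sphere (0 : Fin p → ℝ) 1, 0 < v ⬝ᵥ S *ᵥ v := by
    refine hK.eventually_forall_of_forall_eventually fun v hv => ?_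
    have hc : Continuous fun z : Matrix (Fin p) (Fin p) ℝ × (Fin p → ℝ) =>
      z.2 ⬝ᵥ z.1 *ᵥ z.2 := by fun_prop
    refine hc.continuousAt.eventually_mem (Ioi_mem_nhds ?_)
    have hv0 : v ≠ 0 := by
      rintro rfl
      simp at hv
    simpa using hσ.dotProduct_mulVec_pos hv0
  filter_upwards [h1] with S hS hSs
  refine Matrix.PosDef.of_dotProduct_mulVec_pos hSs fun v hv => ?_
  have hn : 0 < ‖v‖ := norm_pos_iff.2 hv
  have h2 := hS (‖v‖⁻¹ • v) (by simp [norm_smul, hn.ne'])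
  rw [mulVec_smul, smul_dotProduct, dotProduct_smul, smul_smul, smul_eq_mul] at h2
  simpa using pos_of_mul_pos_right h2 (by positivity)

end LinearAlgebra
end FactorAnalysis

namespace FactorAnalysis

/-! ### The covariance map, the fit function and its curvature. -/

section Model

open Matrix

attribute [local instance] Matrix.normedSpace

variable {p q : ℕ}

/-- The directional derivative of `θ ↦ Σ(θ)`. -/
def covDeriv (θ h : Param p q) : Matrix (Fin p) (Fin p) ℝ :=
  loadings h * (loadings θ)ᵀ + loadings θ * (loadings h)ᵀ + errorCov h

@[fun_prop]
theorem continuous_loadings : Continuous (loadings : Param p q → Matrix (Fin p) (Fin q) ℝ) :=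
  continuous_fst

@[fun_prop]
theorem continuous_errorCov : Continuous (errorCov : Param p q → Matrix (Fin p) (Fin p) ℝ) :=
  continuous_snd.matrix_diagonal

@[fun_prop]
theorem continuous_modelCov : Continuous (modelCov : Param p q → Matrix (Fin p) (Fin p) ℝ) := by
  unfold modelCov
  fun_prop

theorem continuous_covDeriv : Continuous fun z : Param p q × Param p q => covDeriv z.1 z.2 := by
  unfold covDeriv
  fun_prop

theorem loadings_add (θ h : Param p q) : loadings (θ + h) = loadings θ + loadings h := rfl

theorem loadings_sub (θ h : Param p q) : loadings (θ - h) = loadings θ - loadings h := rfl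

theorem loadings_smul (t : ℝ) (h : Param p q) : loadings (t • h) = t • loadings h := rfl

theorem errorCov_add (θ h : Param p q) : errorCov (θ + h) = errorCov θ + errorCov h :=
  (Matrix.diagonal_add _ _).symm

theorem errorCov_sub (θ h : Param p q) : errorCov (θ - h) = errorCov θ - errorCov h :=
  (Matrix.diagonal_sub _ _).symm

theorem errorCov_smul (t : ℝ) (h : Param p q) : errorCov (t • h) = t • errorCov h :=
  Matrix.diagonal_smul _ _

theorem norm_errorCov (θ : Param p q) : ‖errorCov θ‖ = ‖θ.2‖ := Matrix.norm_diagonal _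

theorem norm_loadings (θ : Param p q) : ‖loadings θ‖ = ‖θ.1‖ := rfl

theorem norm_param (θ : Param p q) : ‖θ‖ = max ‖loadings θ‖ ‖errorCov θ‖ := by
  rw [norm_errorCov, norm_loadings, Prod.norm_def]

theorem isOpen_paramSpace : IsOpen (paramSpace p q) := by
  simp only [paramSpace, Set.ofPred_forall]
  exact isOpen_iInter_of_finite fun j => isOpen_lt continuous_const (by fun_prop)

theorem modelCov_posDef {θ : Param p q} (hθ : θ ∈ paramSpace p q) : (modelCov θ).PosDef := by
  have h1 : (errorCov θ).PosDef := Matrix.PosDef.diagonal hθ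
  have h2 : (loadings θ * (loadings θ)ᵀ).PosSemidef := by
    simpa using posSemidef_self_mul_conjTranspose (loadings θ)
  unfold modelCov
  rw [add_comm]
  exact h1.add_posSemidef h2

/-- Σ is quadratic in the parameter, so its second-order expansion is exact and no remainder has to
be estimated. -/
theorem modelCov_add_smul (θ h : Param p q) (t : ℝ) :
    modelCov (θ + t • h) =
      modelCov θ + t • (covDeriv θ h + t • (loadings h * (loadings h)ᵀ)) := by
  simp only [modelCov, covDeriv, loadings_add, loadings_smul, errorCov_add, errorCov_smul,
    transpose_add, transpose_smul, Matrix.add_mul, Matrix.mul_add, Matrix.smul_mul,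
    Matrix.mul_smul]
  module

theorem covDeriv_smul (θ h : Param p q) (t : ℝ) : covDeriv θ (t • h) = t • covDeriv θ h := by
  simp only [covDeriv, loadings_smul, errorCov_smul, transpose_smul, Matrix.smul_mul,
    Matrix.mul_smul]
  module

theorem covDeriv_add (θ k h : Param p q) (t : ℝ) :
    covDeriv (θ + t • k) h = covDeriv θ h + t • (loadings h * (loadings k)ᵀ +
      loadings k * (loadings h)ᵀ) := by
  simp only [covDeriv, loadings_add, loadings_smul, transpose_add, transpose_smul, Matrix.add_mul,
    Matrix.mul_add, Matrix.smul_mul, Matrix.mul_smul]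
  module

theorem transpose_covDeriv (θ h : Param p q) : (covDeriv θ h)ᵀ = covDeriv θ h := by
  simp [covDeriv, errorCov, Matrix.transpose_mul, add_comm]

/-- Links the Jacobian hypothesis to the explicit `covDeriv`, by differentiating the exact expansion
along a line. -/
theorem fderiv_modelCov (θ h : Param p q) :
    fderiv ℝ (fun (θ : Param p q) (i j : Fin p) => modelCov θ i j) θ h = covDeriv θ h := by
  have hent : ∀ i j : Fin p, Differentiable ℝ fun θ : Param p q => modelCov θ i j := by
    intro i j
    simp only [modelCov, loadings, errorCov, Matrix.add_apply, Matrix.mul_apply,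
      Matrix.transpose_apply, Matrix.of_apply, Matrix.diagonal_apply]
    by_cases hij : i = j
    · simp only [hij, if_true]; fun_prop
    · simp only [hij, if_false]; fun_prop
  have hd : DifferentiableAt ℝ (fun (θ : Param p q) (i j : Fin p) => modelCov θ i j) θ :=
    differentiableAt_pi.2 fun i => differentiableAt_pi.2 fun j => hent i j θ
  have h0 : (0 : ℝ) • h = 0 := zero_smul _ _
  have hl : HasDerivAt (fun t : ℝ => θ + t • h) h 0 := by
    simpa using ((hasDerivAt_id (0 : ℝ)).smul_const h).const_add θ
  have h1 : HasDerivAt (fun (t : ℝ) (i j : Fin p) => modelCov (θ + t • h) i j)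
      (fderiv ℝ (fun (θ : Param p q) (i j : Fin p) => modelCov θ i j) θ h) 0 := by
    have hd' : HasFDerivAt (fun (θ : Param p q) (i j : Fin p) => modelCov θ i j)
      (fderiv ℝ (fun (θ : Param p q) (i j : Fin p) => modelCov θ i j) θ) (θ + (0 : ℝ) • h) := by
      simpa [h0] using hd.hasFDerivAt
    exact hd'.comp_hasDerivAt (0 : ℝ) hl
  have h2 : HasDerivAt (fun (t : ℝ) (i j : Fin p) => modelCov (θ + t • h) i j)
      (fun i j => covDeriv θ h i j) 0 := by
    refine hasDerivAt_pi.2 fun i => hasDerivAt_pi.2 fun j => ?_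
    simp only [modelCov_add_smul, Matrix.add_apply, Matrix.smul_apply, smul_eq_mul]
    have := ((hasDerivAt_id (0 : ℝ)).mul (((hasDerivAt_id (0 : ℝ)).mul_const
      ((loadings h * (loadings h)ᵀ) i j)).const_add (covDeriv θ h i j))).const_add
        (modelCov θ i j)
    simpa using this
  exact h1.unique h2

/-- In directions orthogonal to the rotations at `θ₀`, the Jacobian of `Σ` is injective. -/
theorem eq_zero_of_covDeriv_eq_zero {θ₀ h : Param p q} (hjac : JacobianNonsingular θ₀)
    (hsymm : ((loadings θ₀)ᵀ * loadings h).IsSymm) (h0 : covDeriv θ₀ h = 0) : h = 0 := by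
  obtain ⟨A, hA, rfl⟩ := hjac h (by rw [fderiv_modelCov, h0]; rfl)
  have hl : loadings (p := p) (q := q) (fun i k => (loadings θ₀ * A) i k, 0) =
    loadings θ₀ * A := rfl
  rw [hl, Matrix.IsSymm] at hsymm
  set L := loadings θ₀
  -- Symmetry makes the Gram matrix LᵀL anticommute with A. Then the squared Frobenius norm of LA,
  -- which is -tr(A LᵀL A), equals its own negative, so LA = 0.
  have h1 : Lᵀ * (L * A) = -(A * (Lᵀ * L)) := by
    rw [← hsymm]
    simp only [transpose_mul, transpose_transpose, hA, Matrix.neg_mul, Matrix.mul_assoc]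
  have h2 : ((L * A)ᴴ * (L * A)).trace = 0 := by
    have e1 : ((L * A)ᴴ * (L * A)).trace = -(A * (Lᵀ * (L * A))).trace := by
      rw [conjTranspose_eq_transpose_of_trivial, transpose_mul, hA]
      simp only [Matrix.neg_mul, Matrix.mul_assoc, trace_neg]
    have e2 : (A * (Lᵀ * (L * A))).trace = -(A * (Lᵀ * (L * A))).trace := by
      conv_lhs => rw [h1, Matrix.mul_neg, trace_neg, Matrix.trace_mul_comm A]
      congr 1
      simp only [Matrix.mul_assoc]
    rw [e1]
    linarith
  rw [trace_conjTranspose_mul_self_eq_zero_iff] at h2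
  rw [h2]
  rfl

theorem loadings_rotate (θ : Param p q) (Q : Matrix (Fin q) (Fin q) ℝ) :
    loadings (rotate θ Q) = loadings θ * Q := rfl

theorem errorCov_rotate (θ : Param p q) (Q : Matrix (Fin q) (Fin q) ℝ) :
    errorCov (rotate θ Q) = errorCov θ := rfl

theorem modelCov_rotate (θ : Param p q) {Q : Matrix (Fin q) (Fin q) ℝ}
    (hQ : Q ∈ orthogonalGroup (Fin q) ℝ) : modelCov (rotate θ Q) = modelCov θ := by
  have hQ' : Q * Qᵀ = 1 := by
    simpa [star_eq_conjTranspose] using (mem_orthogonalGroup_iff (Fin q) ℝ).1 hQ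
  rw [modelCov, loadings_rotate, errorCov_rotate, transpose_mul, Matrix.mul_assoc,
    ← Matrix.mul_assoc Q, hQ', Matrix.one_mul, modelCov]

/-- The part of the negative log-likelihood that depends on the parameter. -/
noncomputable def fitFn (S : Matrix (Fin p) (Fin p) ℝ) (θ : Param p q) : ℝ :=
  Real.log (modelCov θ).det + ((modelCov θ)⁻¹ * S).trace

theorem fitFn_rotate (S : Matrix (Fin p) (Fin p) ℝ) (θ : Param p q)
    {Q : Matrix (Fin q) (Fin q) ℝ} (hQ : Q ∈ orthogonalGroup (Fin q) ℝ) :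
    fitFn S (rotate θ Q) = fitFn S θ := by
  rw [fitFn, modelCov_rotate θ hQ, fitFn]

theorem discrepancy_eq (S : Matrix (Fin p) (Fin p) ℝ) (θ : Param p q) :
    discrepancy S (modelCov θ) = fitFn S θ - p - Real.log S.det := rfl

theorem logLik_eq (n : ℕ) (S : Matrix (Fin p) (Fin p) ℝ) (θ : Param p q) :
    logLik n S θ = -((n : ℝ) * p * Real.log (2 * Real.pi) / 2) - (n : ℝ) / 2 * fitFn S θ := rfl

theorem continuousAt_modelCov_inv {θ : Param p q} (hθ : θ ∈ paramSpace p q) :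
    ContinuousAt (fun θ : Param p q => (modelCov θ)⁻¹) θ :=
  ContinuousAt.comp (f := modelCov) (continuousAt_inv_of_posDef (modelCov_posDef hθ))
    continuous_modelCov.continuousAt

theorem continuousOn_fitFn (S : Matrix (Fin p) (Fin p) ℝ) :
    ContinuousOn (fitFn (q := q) S) (paramSpace p q) := by
  intro θ hθ
  refine ContinuousAt.continuousWithinAt (ContinuousAt.add ?_ ?_)
  · have h1 : Continuous fun θ : Param p q => (modelCov θ).det := by fun_prop
    exact h1.continuousAt.log (modelCov_posDef hθ).det_pos.ne'
  · have h1 : Continuous fun M : Matrix (Fin p) (Fin p) ℝ => (M * S).trace := by fun_prop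
    exact h1.continuousAt.comp (continuousAt_modelCov_inv hθ)

/-- Concavity bounds the log-determinant part; the trace part is exact by the resolvent identity. An
upper bound suffices later, so the log-determinant never has to be differentiated. -/
theorem fitFn_sub_le {S : Matrix (Fin p) (Fin p) ℝ} {θ θ' : Param p q}
    (hθ : θ ∈ paramSpace p q) (hθ' : θ' ∈ paramSpace p q) :
    fitFn S θ' - fitFn S θ ≤ ((modelCov θ)⁻¹ * (modelCov θ' - modelCov θ)).trace -
      ((modelCov θ')⁻¹ * (modelCov θ' - modelCov θ) * (modelCov θ)⁻¹ * S).trace := by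
  have h1 := log_det_sub_log_det_le (modelCov_posDef hθ) (modelCov_posDef hθ')
  have hu : IsUnit (modelCov θ).det := (modelCov_posDef hθ).det_pos.ne'.isUnit
  have hu' : IsUnit (modelCov θ').det := (modelCov_posDef hθ').det_pos.ne'.isUnit
  have h2 : (modelCov θ')⁻¹ * (modelCov θ' - modelCov θ) * (modelCov θ)⁻¹ =
      (modelCov θ)⁻¹ - (modelCov θ')⁻¹ := by
    rw [Matrix.mul_sub, Matrix.sub_mul, nonsing_inv_mul _ hu', Matrix.one_mul, Matrix.mul_assoc,
      mul_nonsing_inv _ hu, Matrix.mul_one]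
  rw [h2, Matrix.sub_mul, trace_sub, fitFn, fitFn]
  linarith

/-- The gradient `Σ⁻¹ - Σ⁻¹ S Σ⁻¹` of the fit function in `Σ`. -/
noncomputable def fitGrad (S : Matrix (Fin p) (Fin p) ℝ) (θ : Param p q) :
    Matrix (Fin p) (Fin p) ℝ :=
  (modelCov θ)⁻¹ - (modelCov θ)⁻¹ * S * (modelCov θ)⁻¹

/-- Turns approximate minimality along a ray into a lower bound on the slope: divide the bound of
`fitFn_sub_le` by t and let t decrease to 0. -/
theorem neg_le_trace_fitGrad_mul {S : Matrix (Fin p) (Fin p) ℝ} {θ h : Param p q}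
    (hθ : θ ∈ paramSpace p q) {K : ℝ}
    (hK : ∀ᶠ t : ℝ in 𝓝[>] 0, fitFn S θ - fitFn S (θ + t • h) ≤ K * t) :
    -K ≤ (fitGrad S θ * covDeriv θ h).trace := by
  have hline : Continuous fun t : ℝ => θ + t • h := by fun_prop
  have hline0 : θ + (0 : ℝ) • h = θ := by simp
  have hmem : ∀ᶠ t : ℝ in 𝓝[>] 0, θ + t • h ∈ paramSpace p q :=
    nhdsWithin_le_nhds ((isOpen_paramSpace.preimage hline).mem_nhds
      (by rwa [Set.mem_preimage, hline0]))
  set k : ℝ → Matrix (Fin p) (Fin p) ℝ :=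
    fun t => covDeriv θ h + t • (loadings h * (loadings h)ᵀ) with hk
  have hbound : ∀ᶠ t : ℝ in 𝓝[>] 0, -K ≤ ((modelCov θ)⁻¹ * k t).trace -
      ((modelCov (θ + t • h))⁻¹ * k t * (modelCov θ)⁻¹ * S).trace := by
    filter_upwards [hK, hmem, self_mem_nhdsWithin] with t ht hm (ht0 : 0 < t)
    have h1 := fitFn_sub_le (S := S) hθ hm
    have h2 : modelCov (θ + t • h) - modelCov θ = t • k t := by
      rw [modelCov_add_smul, add_sub_cancel_left]
    rw [h2] at h1
    simp only [Matrix.mul_smul, Matrix.smul_mul, trace_smul, smul_eq_mul] at h1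
    have h3 : t * -K ≤ t * (((modelCov θ)⁻¹ * k t).trace -
      ((modelCov (θ + t • h))⁻¹ * k t * (modelCov θ)⁻¹ * S).trace) := by linarith
    exact le_of_mul_le_mul_left h3 ht0
  have hkc : Continuous k := by fun_prop
  have hinv : ContinuousAt (fun t : ℝ => (modelCov (θ + t • h))⁻¹) 0 := by
    have := continuousAt_modelCov_inv hθ
    rw [← hline0] at this
    exact ContinuousAt.comp (f := fun t : ℝ => θ + t • h) this hline.continuousAt
  have hc1 : Continuous fun t => ((modelCov θ)⁻¹ * k t).trace := by fun_prop
  have hc2 : Continuous fun z : Matrix (Fin p) (Fin p) ℝ × Matrix (Fin p) (Fin p) ℝ =>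
      (z.1 * z.2 * (modelCov θ)⁻¹ * S).trace :=
    (((continuous_fst.matrix_mul continuous_snd).matrix_mul continuous_const).matrix_mul
      continuous_const).matrix_trace
  have hlim1 : Tendsto (fun t => ((modelCov θ)⁻¹ * k t).trace) (𝓝[>] 0)
      (𝓝 ((modelCov θ)⁻¹ * k 0).trace) :=
    tendsto_nhdsWithin_of_tendsto_nhds (hc1.tendsto 0)
  have hpair : Tendsto (fun t => ((modelCov (θ + t • h))⁻¹, k t)) (𝓝[>] 0)
      (𝓝 ((modelCov (θ + (0 : ℝ) • h))⁻¹, k 0)) :=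
    tendsto_nhdsWithin_of_tendsto_nhds (hinv.tendsto.prodMk_nhds (hkc.tendsto 0))
  have hlim2 := (hc2.tendsto _).comp hpair
  have h5 := ge_of_tendsto (hlim1.sub hlim2) hbound
  have hk0 : k 0 = covDeriv θ h := by simp [hk]
  rw [hk0, hline0] at h5
  rw [fitGrad, Matrix.sub_mul, trace_sub]
  have e : ((modelCov θ)⁻¹ * S * (modelCov θ)⁻¹ * covDeriv θ h).trace =
      ((modelCov θ)⁻¹ * covDeriv θ h * (modelCov θ)⁻¹ * S).trace := by
    rw [Matrix.mul_assoc ((modelCov θ)⁻¹ * S), Matrix.trace_mul_comm]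
    simp only [Matrix.mul_assoc]
  rwa [e]

/-- The quadratic form in `u` bounding from below the increment of the fit gradient between two
parameters with mean `m` and inverse covariance matrices `A` and `B`. -/
noncomputable def curvature (S A B : Matrix (Fin p) (Fin p) ℝ) (m u : Param p q) : ℝ :=
  ((-(B * covDeriv m u * A) + B * covDeriv m u * A * S * B + A * S * B * covDeriv m u * A) *
    covDeriv m u).trace +
  ((A - A * S * A + (B - B * S * B)) * (loadings u * (loadings u)ᵀ)).trace

theorem curvature_smul (S A B : Matrix (Fin p) (Fin p) ℝ) (m u : Param p q) (t : ℝ) :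
    curvature S A B m (t • u) = t ^ 2 * curvature S A B m u := by
  simp only [curvature, covDeriv_smul, loadings_smul, transpose_smul, Matrix.smul_mul,
    Matrix.mul_smul, ← smul_neg, ← smul_add, trace_smul, smul_eq_mul]
  ring

/-- An exact identity based on the midpoint. With D the derivative there along d = b - a and E =
Λ(d)Λ(d)ᵀ, one has Σ(b) - Σ(a) = D, while the derivatives at a and b are D - E and D + E. -/
theorem curvature_eq {S : Matrix (Fin p) (Fin p) ℝ} {a b : Param p q}
    (ha : a ∈ paramSpace p q) (hb : b ∈ paramSpace p q) :
    curvature S (modelCov a)⁻¹ (modelCov b)⁻¹ (a + (1 / 2 : ℝ) • (b - a)) (b - a) =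
      (fitGrad S b * covDeriv b (b - a)).trace - (fitGrad S a * covDeriv a (b - a)).trace := by
  have hua : IsUnit (modelCov a).det := (modelCov_posDef ha).det_pos.ne'.isUnit
  have hub : IsUnit (modelCov b).det := (modelCov_posDef hb).det_pos.ne'.isUnit
  set d := b - a with hd
  have hbd : b = a + (1 : ℝ) • d := by simp [hd]
  set D := covDeriv (a + (1 / 2 : ℝ) • d) d with hD
  set E := loadings d * (loadings d)ᵀ with hE
  have h1 : covDeriv a d = D - E := by
    rw [hD, covDeriv_add]; module
  have h2 : covDeriv b d = D + E := by
    rw [hD, covDeriv_add]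
    conv_lhs => rw [hbd, covDeriv_add]
    module
  have h3 : modelCov b - modelCov a = D := by
    conv_lhs => rw [hbd, modelCov_add_smul]
    rw [h1]; module
  set A := (modelCov a)⁻¹ with hA
  set B := (modelCov b)⁻¹ with hB
  have h4 : B - A = -(B * D * A) := by
    rw [← h3, Matrix.mul_sub, Matrix.sub_mul, nonsing_inv_mul _ hub, Matrix.one_mul,
      Matrix.mul_assoc, mul_nonsing_inv _ hua, Matrix.mul_one, neg_sub]
  have h5 : fitGrad S b - fitGrad S a = -(B * D * A) + B * D * A * S * B + A * S * B * D * A := by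
    have e : fitGrad S b - fitGrad S a = (B - A) - (B - A) * S * B - A * S * (B - A) := by
      rw [fitGrad, fitGrad]
      noncomm_ring
    rw [e, h4]
    noncomm_ring
  rw [curvature, ← hD, ← hE, ← h5, h1, h2]
  have e1 : A - A * S * A = fitGrad S a := rfl
  have e2 : B - B * S * B = fitGrad S b := rfl
  rw [e1, e2]
  simp only [Matrix.mul_add, Matrix.mul_sub, Matrix.add_mul, Matrix.sub_mul, trace_add, trace_sub]
  ring

theorem continuous_curvature {X : Type*} [TopologicalSpace X]
    {S A B : X → Matrix (Fin p) (Fin p) ℝ} {m u : X → Param p q} (hS : Continuous S)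
    (hA : Continuous A) (hB : Continuous B) (hm : Continuous m) (hu : Continuous u) :
    Continuous fun x => curvature (S x) (A x) (B x) (m x) (u x) := by
  have hD : Continuous fun x => covDeriv (m x) (u x) := continuous_covDeriv.comp (hm.prodMk hu)
  have hE : Continuous fun x => loadings (u x) * (loadings (u x))ᵀ :=
    (continuous_loadings.comp hu).matrix_mul (continuous_loadings.comp hu).matrix_transpose
  have hASB := (hA.matrix_mul hS).matrix_mul hB
  have hBDA := (hB.matrix_mul hD).matrix_mul hA
  refine Continuous.add (Continuous.matrix_trace (Continuous.matrix_mul ?_ hD))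
    (Continuous.matrix_trace (Continuous.matrix_mul ?_ hE))
  · exact (hBDA.neg.add ((hBDA.matrix_mul hS).matrix_mul hB)).add
      ((hASB.matrix_mul hD).matrix_mul hA)
  · exact (hA.sub ((hA.matrix_mul hS).matrix_mul hA)).add
      (hB.sub ((hB.matrix_mul hS).matrix_mul hB))

/-- At the base point, with W = Σ₀⁻¹, the form reduces to tr(WDWD), which is positive on the aligned
directions because D ≠ 0 there. Compactness of their unit sphere makes the bound uniform and stable
under perturbation; homogeneity extends it to all aligned u. -/
theorem exists_curvature_ge {θ₀ : Param p q} (hθ₀ : θ₀ ∈ paramSpace p q)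
    (hjac : JacobianNonsingular θ₀) :
    ∃ c : ℝ, 0 < c ∧ ∀ᶠ z : Matrix (Fin p) (Fin p) ℝ × Matrix (Fin p) (Fin p) ℝ ×
        Matrix (Fin p) (Fin p) ℝ × Param p q in
        𝓝 (modelCov θ₀, (modelCov θ₀)⁻¹, (modelCov θ₀)⁻¹, θ₀),
      ∀ u : Param p q, ((loadings θ₀)ᵀ * loadings u).IsSymm →
        c * ‖u‖ ^ 2 ≤ curvature z.1 z.2.1 z.2.2.1 z.2.2.2 u := by
  set W := (modelCov θ₀)⁻¹ with hW
  have hu : IsUnit (modelCov θ₀).det := (modelCov_posDef hθ₀).det_pos.ne'.isUnit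
  set K : Set (Param p q) := Metric.sphere 0 1 ∩ {u | ((loadings θ₀)ᵀ * loadings u).IsSymm} with hK
  have hKc : IsCompact K := by
    refine (isCompact_sphere _ _).inter_right ?_
    simp only [Matrix.IsSymm]
    exact isClosed_eq (by fun_prop) (by fun_prop)
  have hcont : Continuous fun z : (Matrix (Fin p) (Fin p) ℝ × Matrix (Fin p) (Fin p) ℝ ×
      Matrix (Fin p) (Fin p) ℝ × Param p q) × Param p q =>
      curvature z.1.1 z.1.2.1 z.1.2.2.1 z.1.2.2.2 z.2 :=
    continuous_curvature (by fun_prop) (by fun_prop) (by fun_prop) (by fun_prop) (by fun_prop)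
  have hpos : ∀ u ∈ K, 0 < curvature (modelCov θ₀) W W θ₀ u := by
    rintro u ⟨hu1, hu2⟩
    have hne : covDeriv θ₀ u ≠ 0 := by
      intro h0
      rw [eq_zero_of_covDeriv_eq_zero hjac hu2 h0] at hu1
      simp at hu1
    have e : curvature (modelCov θ₀) W W θ₀ u =
        (W * covDeriv θ₀ u * W * covDeriv θ₀ u).trace := by
      have e1 : W * modelCov θ₀ = 1 := nonsing_inv_mul _ hu
      have e2 : W * covDeriv θ₀ u * W * modelCov θ₀ * W = W * covDeriv θ₀ u * W := by
        rw [Matrix.mul_assoc (W * covDeriv θ₀ u), e1, Matrix.mul_one]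
      rw [curvature, e2, e1, Matrix.one_mul, sub_self, add_zero, Matrix.zero_mul, trace_zero,
        add_zero, neg_add_cancel, zero_add]
    rw [e]
    exact trace_mul_mul_mul_pos (modelCov_posDef hθ₀).inv (transpose_covDeriv _ _) hne
  obtain ⟨c, hc, hcK⟩ : ∃ c : ℝ, 0 < c ∧ ∀ u ∈ K, c < curvature (modelCov θ₀) W W θ₀ u := by
    rcases K.eq_empty_or_nonempty with he | hne
    · exact ⟨1, one_pos, by simp [he]⟩
    · have hc0 : Continuous fun u => curvature (modelCov θ₀) W W θ₀ u :=
        continuous_curvature continuous_const continuous_const continuous_const continuous_const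
          continuous_id
      obtain ⟨u₀, hu₀, hmin⟩ := hKc.exists_isMinOn hne hc0.continuousOn
      refine ⟨_, half_pos (hpos u₀ hu₀), fun u hu => ?_⟩
      have h1 : curvature (modelCov θ₀) W W θ₀ u₀ ≤ curvature (modelCov θ₀) W W θ₀ u := hmin hu
      linarith [hpos u₀ hu₀]
  refine ⟨c, hc, ?_⟩
  have hev : ∀ᶠ z : Matrix (Fin p) (Fin p) ℝ × Matrix (Fin p) (Fin p) ℝ ×
      Matrix (Fin p) (Fin p) ℝ × Param p q in 𝓝 (modelCov θ₀, W, W, θ₀),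
      ∀ u ∈ K, c < curvature z.1 z.2.1 z.2.2.1 z.2.2.2 u := by
    refine hKc.eventually_forall_of_forall_eventually fun u hu => ?_
    have h1 := hcK u hu
    have h2 := hcont.tendsto ((modelCov θ₀, W, W, θ₀), u)
    exact h2.eventually_const_lt h1
  filter_upwards [hev] with z hz u hsymm
  rcases eq_or_ne u 0 with rfl | hu0
  · have := curvature_smul z.1 z.2.1 z.2.2.1 z.2.2.2 (0 : Param p q) 0
    simp only [smul_zero] at this
    rw [this]
    simp
  · have hn : 0 < ‖u‖ := norm_pos_iff.2 hu0
    have h1 := hz (‖u‖⁻¹ • u) ⟨by simp [norm_smul, hn.ne'], by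
      simpa [loadings_smul] using hsymm.smul ‖u‖⁻¹⟩
    rw [curvature_smul, inv_pow, lt_inv_mul_iff₀ (by positivity)] at h1
    linarith

end Model
end FactorAnalysis

namespace FactorAnalysis

/-! ### Deterministic bounds for the two kinds of estimates. -/

section Estimates

open Matrix

attribute [local instance] Matrix.normedSpace

variable {p q : ℕ}

/-- Kano's condition and identifiability supply some rotation close to θ₀; the Procrustes rotation
is worse by at most √(qp) and in addition satisfies the symmetry condition. -/
theorem exists_aligned {θ₀ : Param p q} (hident : StronglyIdentifiable θ₀)
    (hkano : KanoCondition θ₀) {ε : ℝ} (hε : 0 < ε) :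
    ∃ δ : ℝ, 0 < δ ∧ ∀ S : Matrix (Fin p) (Fin p) ℝ, S.PosDef → ‖S - modelCov θ₀‖ < δ →
      ∀ θ ∈ paramSpace p q, discrepancy S (modelCov θ) < δ →
        ∃ Q ∈ orthogonalGroup (Fin q) ℝ,
          ((loadings θ₀)ᵀ * loadings (rotate θ Q)).IsSymm ∧ ‖rotate θ Q - θ₀‖ < ε := by
  -- The added 1 keeps `r` at least 1, which covers the error variances and the case `q = 0`.
  set r := Real.sqrt (q * p) + 1 with hr
  have hr1 : 1 ≤ r := by rw [hr]; linarith [Real.sqrt_nonneg ((q : ℝ) * p)]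
  have hr0 : 0 < r := by linarith
  obtain ⟨δ₁, hδ₁, h₁⟩ := hident (ε / r) (by positivity)
  obtain ⟨δ, hδ, h₂⟩ := hkano δ₁ hδ₁
  refine ⟨δ, hδ, fun S hS hSδ θ hθ hF => ?_⟩
  have h3 := h₂ S hS θ hθ hSδ hF
  rw [norm_sub_rev] at h3
  obtain ⟨Q', hQ', hL, hE⟩ := h₁ θ hθ h3
  obtain ⟨Q, hQ, hsymm, hmin⟩ := exists_procrustes (loadings θ) (loadings θ₀)
  refine ⟨Q, hQ, hsymm, ?_⟩
  rw [norm_param, loadings_sub, errorCov_sub, loadings_rotate, errorCov_rotate, max_lt_iff]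
  rw [norm_sub_rev] at hL hE
  rw [lt_div_iff₀ hr0] at hL hE
  constructor
  · refine (hmin Q' hQ').trans_lt (lt_of_le_of_lt ?_ hL)
    rw [mul_comm]
    gcongr
    rw [hr]; linarith
  · exact lt_of_le_of_lt (le_mul_of_one_le_right (norm_nonneg _) hr1) hE

theorem eventually_discrepancy_lt {θ₀ : Param p q} (hθ₀ : θ₀ ∈ paramSpace p q) {δ : ℝ}
    (hδ : 0 < δ) : ∀ᶠ S in 𝓝 (modelCov θ₀), discrepancy S (modelCov θ₀) < δ := by
  have hdet := (modelCov_posDef hθ₀).det_pos.ne'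
  have h0 : discrepancy (modelCov θ₀) (modelCov θ₀) = 0 := by
    rw [discrepancy, nonsing_inv_mul _ hdet.isUnit, trace_one, Fintype.card_fin]
    ring
  have h1 : Continuous fun S : Matrix (Fin p) (Fin p) ℝ => S.det := by fun_prop
  have h2 : Continuous fun S : Matrix (Fin p) (Fin p) ℝ =>
    Real.log (modelCov θ₀).det + ((modelCov θ₀)⁻¹ * S).trace - p := by fun_prop
  have h3 : Tendsto (fun S => discrepancy S (modelCov θ₀)) (𝓝 (modelCov θ₀))
      (𝓝 (discrepancy (modelCov θ₀) (modelCov θ₀))) :=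
    (h2.tendsto _).sub ((h1.tendsto _).log hdet)
  rw [h0] at h3
  exact h3.eventually_lt_const hδ

theorem fitFn_le_of_mem_mlEstimates {n : ℕ} (hn : 0 < n) {S : Matrix (Fin p) (Fin p) ℝ}
    {θ θ' : Param p q} (hθ : θ ∈ mlEstimates n S) (hθ' : θ' ∈ paramSpace p q) :
    fitFn S θ ≤ fitFn S θ' := by
  have h : logLik n S θ' ≤ logLik n S θ := hθ.2 hθ'
  rw [logLik_eq, logLik_eq] at h
  have hn' : (0 : ℝ) < (n : ℝ) / 2 := by positivity
  exact le_of_mul_le_mul_left (by linarith) hn'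

theorem fitFn_sub_le_of_mem_mplEstimates {n : ℕ} (hn : 0 < n) {S : Matrix (Fin p) (Fin p) ℝ}
    {P : Param p q → ℝ} {θ θ' : Param p q} (hθ : θ ∈ mplEstimates n S P)
    (hθ' : θ' ∈ paramSpace p q) : fitFn S θ - fitFn S θ' ≤ 2 / n * (P θ - P θ') := by
  have h : logLik n S θ' + P θ' ≤ logLik n S θ + P θ := hθ.2 hθ'
  rw [logLik_eq, logLik_eq] at h
  have hn' : (0 : ℝ) < n := by positivity
  rw [div_mul_eq_mul_div, le_div_iff₀ hn']
  linarith

/-- A parameter with discrepancy at least δ fits worse than θ₀, and any other can be rotated,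
without changing its fit, into a compact ball around θ₀. So a minimiser on the ball is global. -/
theorem eventually_mlEstimates_nonempty {θ₀ : Param p q} (hθ₀ : θ₀ ∈ paramSpace p q)
    (hident : StronglyIdentifiable θ₀) (hkano : KanoCondition θ₀) :
    ∀ᶠ S in 𝓝 (modelCov θ₀), S.PosDef → ∀ n, (mlEstimates (q := q) n S).Nonempty := by
  obtain ⟨ε, hε, hball⟩ := Metric.nhds_basis_closedBall.mem_iff.1 (isOpen_paramSpace.mem_nhds hθ₀)
  obtain ⟨δ, hδ, hal⟩ := exists_aligned hident hkano hε
  filter_upwards [eventually_discrepancy_lt hθ₀ hδ, Metric.ball_mem_nhds _ hδ] with S hS1 hS2 hpd n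
  rw [mem_ball_iff_norm] at hS2
  obtain ⟨θ, hθ, hmin⟩ := (isCompact_closedBall θ₀ ε).exists_isMinOn
    ⟨θ₀, Metric.mem_closedBall_self hε.le⟩ ((continuousOn_fitFn S).mono hball)
  refine ⟨θ, hball hθ, fun θ' hθ' => ?_⟩
  have key : fitFn S θ ≤ fitFn S θ' := by
    by_cases hF : discrepancy S (modelCov θ') < δ
    · obtain ⟨Q, hQ, -, hQε⟩ := hal S hpd hS2 θ' hθ' hF
      have h1 : fitFn S θ ≤ fitFn S (rotate θ' Q) := hmin (by
        rw [mem_closedBall_iff_norm]; exact hQε.le)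
      rwa [fitFn_rotate S θ' hQ] at h1
    · have h1 : fitFn S θ ≤ fitFn S θ₀ := hmin (Metric.mem_closedBall_self hε.le)
      rw [discrepancy_eq] at hS1 hF
      linarith
  change logLik n S θ' ≤ logLik n S θ
  rw [logLik_eq, logLik_eq]
  have := mul_le_mul_of_nonneg_left key (by positivity : (0 : ℝ) ≤ (n : ℝ) / 2)
  linarith

/-- Strong monotonicity of the gradient between an exact minimiser `a` and a point `b` that is
minimal up to slope `K`. Alignment is used only through the symmetry of the difference `b - a`. -/
theorem exists_norm_sub_le {θ₀ : Param p q} (hθ₀ : θ₀ ∈ paramSpace p q)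
    (hjac : JacobianNonsingular θ₀) :
    ∃ c : ℝ, 0 < c ∧ ∃ r : ℝ, 0 < r ∧ ∀ (S : Matrix (Fin p) (Fin p) ℝ) (a b : Param p q),
      ‖S - modelCov θ₀‖ < r → ‖a - θ₀‖ < r → ‖b - θ₀‖ < r →
      a ∈ paramSpace p q → b ∈ paramSpace p q →
      ((loadings θ₀)ᵀ * loadings a).IsSymm → ((loadings θ₀)ᵀ * loadings b).IsSymm →
      ∀ K : ℝ, 0 ≤ K →
      (∀ θ ∈ paramSpace p q, fitFn S a ≤ fitFn S θ) →
      (∀ᶠ θ in 𝓝 b, fitFn S b - fitFn S θ ≤ K * ‖θ - b‖) →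
      c * ‖b - a‖ ≤ K := by
  obtain ⟨c, hc, hev⟩ := exists_curvature_ge hθ₀ hjac
  have hinv := continuousAt_modelCov_inv hθ₀
  have hz : Tendsto (fun y : Matrix (Fin p) (Fin p) ℝ × Param p q × Param p q =>
      (y.1, (modelCov y.2.1)⁻¹, (modelCov y.2.2)⁻¹, y.2.1 + (1 / 2 : ℝ) • (y.2.2 - y.2.1)))
      (𝓝 (modelCov θ₀, θ₀, θ₀))
      (𝓝 (modelCov θ₀, (modelCov θ₀)⁻¹, (modelCov θ₀)⁻¹, θ₀)) := by
    refine Tendsto.prodMk_nhds (continuous_fst.tendsto _) (Tendsto.prodMk_nhds ?_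
      (Tendsto.prodMk_nhds ?_ ?_))
    · exact hinv.tendsto.comp ((continuous_fst.comp continuous_snd).tendsto (modelCov θ₀, θ₀, θ₀))
    · exact hinv.tendsto.comp ((continuous_snd.comp continuous_snd).tendsto (modelCov θ₀, θ₀, θ₀))
    · have h1 : Continuous fun y : Matrix (Fin p) (Fin p) ℝ × Param p q × Param p q =>
        y.2.1 + (1 / 2 : ℝ) • (y.2.2 - y.2.1) := by fun_prop
      simpa using h1.tendsto (modelCov θ₀, θ₀, θ₀)
  obtain ⟨r, hr, hball⟩ := Metric.eventually_nhds_iff.1 (hz.eventually hev)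
  refine ⟨c, hc, r, hr, fun S a b hS ha hb haΘ hbΘ has hbs K hK hmin hpen => ?_⟩
  have hdist : dist (S, a, b) (modelCov θ₀, θ₀, θ₀) < r := by
    rw [Prod.dist_eq, Prod.dist_eq, dist_eq_norm, dist_eq_norm, dist_eq_norm]
    exact max_lt hS (max_lt ha hb)
  have h1 := hball hdist (b - a) (by
    rw [loadings_sub, Matrix.mul_sub]
    exact hbs.sub has)
  rw [curvature_eq haΘ hbΘ] at h1
  have hline : Continuous fun t : ℝ => a + t • (b - a) := by fun_prop
  have h2 : -0 ≤ (fitGrad S a * covDeriv a (b - a)).trace := by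
    refine neg_le_trace_fitGrad_mul haΘ ?_
    have : ∀ᶠ t : ℝ in 𝓝[>] 0, a + t • (b - a) ∈ paramSpace p q :=
      nhdsWithin_le_nhds ((isOpen_paramSpace.preimage hline).mem_nhds
        (by simpa using haΘ))
    filter_upwards [this] with t ht
    linarith [hmin _ ht]
  -- The slope at `b` is taken back towards `a`, so that the two bounds combine into an upper bound
  -- for the curvature.
  have h3 : -(K * ‖b - a‖) ≤ (fitGrad S b * covDeriv b ((-1 : ℝ) • (b - a))).trace := by
    refine neg_le_trace_fitGrad_mul hbΘ ?_
    have hline' : Tendsto (fun t : ℝ => b + t • ((-1 : ℝ) • (b - a))) (𝓝[>] 0) (𝓝 b) := by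
      have : Continuous fun t : ℝ => b + t • ((-1 : ℝ) • (b - a)) := by fun_prop
      exact tendsto_nhdsWithin_of_tendsto_nhds (by simpa using this.tendsto 0)
    filter_upwards [hline'.eventually hpen, self_mem_nhdsWithin] with t ht (ht0 : 0 < t)
    refine ht.trans_eq ?_
    rw [add_sub_cancel_left, norm_smul, norm_smul, norm_neg, norm_one, Real.norm_eq_abs,
      abs_of_pos ht0]
    ring
  rw [covDeriv_smul, Matrix.mul_smul, trace_smul, smul_eq_mul] at h3
  rcases eq_or_ne (b - a) 0 with h0 | h0
  · rw [h0, norm_zero, mul_zero]; exact hK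
  · have hn : 0 < ‖b - a‖ := norm_pos_iff.2 h0
    refine le_of_mul_le_mul_right ?_ hn
    nlinarith

/-- Deterministic core: if `S` is close to `Σ(θ₀)` and the penalty is small relative to `√n`, the
ML estimates exist, and the penalised and unpenalised estimates can be rotated so as to be close to
`θ₀` and at a distance controlled by the gradient of the penalty. -/
theorem exists_rotations {θ₀ : Param p q} (hθ₀ : θ₀ ∈ paramSpace p q)
    (hident : StronglyIdentifiable θ₀) (hjac : JacobianNonsingular θ₀)
    (hkano : KanoCondition θ₀) {U : Set (Param p q)} (hU : U ∈ 𝓝 θ₀) :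
    ∃ C : ℝ, 0 < C ∧ ∀ ε : ℝ, 0 < ε → ∃ δ : ℝ, 0 < δ ∧
      ∀ S : Matrix (Fin p) (Fin p) ℝ, S.IsHermitian → ‖S - modelCov θ₀‖ < δ →
      ∀ n : ℕ, 0 < n → ∀ P : Param p q → ℝ, (∀ θ ∈ paramSpace p q, P θ ≤ 0) →
      ContDiffOn ℝ 1 P (paramSpace p q) →
      (∀ θ ∈ paramSpace p q, ∀ Q ∈ orthogonalGroup (Fin q) ℝ, P (rotate θ Q) = P θ) →
      |P θ₀ / Real.sqrt n| < δ → ∀ K : ℝ, 0 ≤ K → (∀ θ ∈ U, ‖fderiv ℝ P θ‖ ≤ K) →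
      (mlEstimates (q := q) n S).Nonempty ∧
      ∀ θt ∈ mplEstimates n S P, ∀ θh ∈ mlEstimates n S,
        ∃ Q₁ ∈ orthogonalGroup (Fin q) ℝ, ∃ Q₂ ∈ orthogonalGroup (Fin q) ℝ,
          ‖rotate θt Q₁ - θ₀‖ < ε ∧ ‖rotate θh Q₂ - θ₀‖ < ε ∧
          ‖rotate θt Q₁ - rotate θh Q₂‖ ≤ C * K / n := by
  obtain ⟨c, hc, r, hr, hcr⟩ := exists_norm_sub_le hθ₀ hjac
  refine ⟨2 / c, by positivity, fun ε hε => ?_⟩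
  obtain ⟨s, hs, hsU⟩ := Metric.mem_nhds_iff.1
    (inter_mem hU (isOpen_paramSpace.mem_nhds hθ₀))
  obtain ⟨δ₀, hδ₀, hal⟩ := exists_aligned hident hkano (lt_min hε (lt_min hr hs))
  obtain ⟨δ₁, hδ₁, hball⟩ := Metric.eventually_nhds_iff.1
    ((eventually_discrepancy_lt hθ₀ (half_pos hδ₀)).and
      ((eventually_posDef (modelCov_posDef hθ₀)).and
        (eventually_mlEstimates_nonempty hθ₀ hident hkano)))
  -- The quarter makes the penalty contribution 2|P(θ₀)|/√n less than δ₀/2; the discrepancy at θ₀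
  -- uses up the other half.
  refine ⟨min (min r (δ₀ / 4)) δ₁, by positivity, ?_⟩
  intro S hSh hSδ n hn P hPn hPd hPr hP0 K hK hPK
  simp only [lt_min_iff] at hSδ hP0
  obtain ⟨⟨hSr, hS0⟩, hS1⟩ := hSδ
  obtain ⟨hF, hpd, hml⟩ := hball (by rwa [dist_eq_norm])
  replace hpd := hpd hSh
  have hn' : (0 : ℝ) < n := by exact_mod_cast hn
  refine ⟨hml hpd n, fun θt hθt θh hθh => ?_⟩
  have hS0' : ‖S - modelCov θ₀‖ < δ₀ := by linarith
  have hFh : discrepancy S (modelCov θh) < δ₀ := by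
    have := fitFn_le_of_mem_mlEstimates hn hθh hθ₀
    rw [discrepancy_eq] at hF ⊢
    linarith
  have hFt : discrepancy S (modelCov θt) < δ₀ := by
    have h1 := fitFn_sub_le_of_mem_mplEstimates hn hθt hθ₀
    have h2 : 2 / n * (P θt - P θ₀) ≤ 2 * |P θ₀ / Real.sqrt n| := by
      have hsq1 : (1 : ℝ) ≤ Real.sqrt n := by
        rw [Real.one_le_sqrt]; exact_mod_cast hn
      have hsq : (n : ℝ) = Real.sqrt n * Real.sqrt n := (Real.mul_self_sqrt hn'.le).symm
      have h3 : P θt - P θ₀ ≤ |P θ₀| := by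
        linarith [hPn θt hθt.1, neg_abs_le (P θ₀)]
      calc 2 / n * (P θt - P θ₀) ≤ 2 / n * |P θ₀| := by gcongr
        _ ≤ 2 / Real.sqrt n * |P θ₀| := by
            gcongr
            nlinarith
        _ = _ := by
            rw [abs_div, abs_of_nonneg (Real.sqrt_nonneg _)]; ring
    rw [discrepancy_eq] at hF ⊢
    linarith [hP0.1.2]
  obtain ⟨Q₁, hQ₁, hs₁, hn₁⟩ := hal S hpd hS0' θt hθt.1 hFt
  obtain ⟨Q₂, hQ₂, hs₂, hn₂⟩ := hal S hpd hS0' θh hθh.1 hFh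
  simp only [lt_min_iff] at hn₁ hn₂
  refine ⟨Q₁, hQ₁, Q₂, hQ₂, hn₁.1, hn₂.1, ?_⟩
  set b := rotate θt Q₁ with hb
  set a := rotate θh Q₂ with ha
  have hbs : b ∈ Metric.ball θ₀ s := by rw [mem_ball_iff_norm]; exact hn₁.2.2
  have h4 : c * ‖b - a‖ ≤ 2 / n * K := by
    refine hcr S a b hSr hn₂.2.1 hn₁.2.1 hθh.1 hθt.1 hs₂ hs₁ _ (by positivity) ?_ ?_
    · intro θ hθ
      rw [ha, fitFn_rotate S θh hQ₂]
      exact fitFn_le_of_mem_mlEstimates hn hθh hθ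
    · filter_upwards [Metric.isOpen_ball.mem_nhds hbs] with θ hθ
      rw [hb, fitFn_rotate S θt hQ₁, ← hb]
      refine (fitFn_sub_le_of_mem_mplEstimates hn hθt (hsU hθ).2).trans ?_
      -- Rotation invariance moves the penalty to the aligned point, which lies in a convex ball
      -- inside U where the gradient bound is a Lipschitz bound.
      rw [← hPr θt hθt.1 Q₁ hQ₁, ← hb, mul_assoc]
      gcongr
      rw [norm_sub_rev]
      refine (le_abs_self _).trans ?_
      exact (convex_ball θ₀ s).norm_image_sub_le_of_norm_fderiv_le
        (fun x hx => (hPd.contDiffAt (isOpen_paramSpace.mem_nhds (hsU hx).2)).differentiableAt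
          (by simp)) (fun x hx => hPK x (hsU hx).1) hθ hbs
  have h5 : 2 / c * K / n = (2 / n * K) / c := by ring
  rw [h5, le_div_iff₀ hc]
  linarith

theorem isHermitian_sampleCov {n : ℕ} (x : Fin n → Fin p → ℝ) : (sampleCov x).IsHermitian := by
  unfold Matrix.IsHermitian sampleCov
  simp [transpose_smul, transpose_sum, Matrix.transpose_vecMulVec]

end Estimates
end FactorAnalysis

namespace FactorAnalysis

/-! ### Measurable rotations and convergence in probability. -/

section Asymptotics

open Matrix

attribute [local instance] Matrix.normedSpace

variable {p q : ℕ} {Ω : Type*} [MeasurableSpace Ω]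

theorem MeasurableEntries.measurable_norm {X : Ω → Matrix (Fin p) (Fin q) ℝ}
    (hX : MeasurableEntries X) : Measurable fun ω => ‖X ω‖ := by
  have h : Measurable fun ω => (fun i j => X ω i j : Fin p → Fin q → ℝ) :=
    measurable_pi_iff.2 fun i => measurable_pi_iff.2 fun j => hX i j
  exact h.norm

theorem MeasurableEntries.mul {k : ℕ} {X : Ω → Matrix (Fin p) (Fin k) ℝ}
    {Y : Ω → Matrix (Fin k) (Fin q) ℝ} (hX : MeasurableEntries X) (hY : MeasurableEntries Y) :
    MeasurableEntries fun ω => X ω * Y ω := by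
  intro i j
  simp only [Matrix.mul_apply]
  exact Finset.measurable_sum _ fun l _ => (hX i l).mul (hY l j)

theorem MeasurableEntries.sub {X Y : Ω → Matrix (Fin p) (Fin q) ℝ}
    (hX : MeasurableEntries X) (hY : MeasurableEntries Y) :
    MeasurableEntries fun ω => X ω - Y ω := fun i j => (hX i j).sub (hY i j)

theorem measurableEntries_const (X : Matrix (Fin p) (Fin q) ℝ) :
    MeasurableEntries fun _ : Ω => X := fun _ _ => measurable_const

theorem measurableEntries_loadings {θ : Ω → Param p q} (hθ : Measurable θ) :
    MeasurableEntries fun ω => loadings (θ ω) := fun i j =>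
  (measurable_pi_apply j).comp ((measurable_pi_apply i).comp (measurable_fst.comp hθ))

/-- A measurable selection of nearly optimal rotations of `M` towards `N`. -/
theorem exists_measurable_rotation {M N : Ω → Matrix (Fin p) (Fin q) ℝ}
    (hM : MeasurableEntries M) (hN : MeasurableEntries N) {ε : ℝ} (hε : 0 < ε) :
    ∃ Q : Ω → Matrix (Fin q) (Fin q) ℝ, MeasurableEntries Q ∧
      (∀ ω, Q ω ∈ orthogonalGroup (Fin q) ℝ) ∧
      ∀ ω, ∀ Q' ∈ orthogonalGroup (Fin q) ℝ, ‖M ω * Q ω - N ω‖ ≤ ‖M ω * Q' - N ω‖ + ε := by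
  classical
  have : SecondCountableTopology (orthogonalGroup (Fin q) ℝ) :=
    Topology.IsEmbedding.subtypeVal.secondCountableTopology
  let D : ℕ → orthogonalGroup (Fin q) ℝ := TopologicalSpace.denseSeq _
  have hD : DenseRange D := TopologicalSpace.denseRange_denseSeq _
  let f : ℕ → Ω → ℝ := fun k ω => ‖M ω * (D k : Matrix (Fin q) (Fin q) ℝ) - N ω‖
  have hf : ∀ k, Measurable (f k) := fun k =>
    ((hM.mul (measurableEntries_const _)).sub hN).measurable_norm
  have hbdd : ∀ ω, BddBelow (Set.range fun k => f k ω) := fun ω =>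
    ⟨0, by rintro _ ⟨k, rfl⟩; exact norm_nonneg _⟩
  have hinf : Measurable fun ω => ⨅ k, f k ω := Measurable.iInf hf
  have hex : ∀ ω, ∃ k, f k ω < (⨅ k, f k ω) + ε := fun ω =>
    exists_lt_of_ciInf_lt (lt_add_of_pos_right _ hε)
  -- Taking the first index in a dense sequence that comes within ε of the infimum makes the
  -- selection measurable.
  have hfind : Measurable fun ω => Nat.find (hex ω) :=
    measurable_find hex fun k => measurableSet_lt (hf k) (hinf.add_const ε)
  refine ⟨fun ω => (D (Nat.find (hex ω)) : Matrix (Fin q) (Fin q) ℝ), fun i j => ?_,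
    fun ω => (D _).2, fun ω Q' hQ' => ?_⟩
  · exact (measurable_from_nat (f := fun k => (D k : Matrix (Fin q) (Fin q) ℝ) i j)).comp hfind
  · have h1 : f (Nat.find (hex ω)) ω < (⨅ k, f k ω) + ε := Nat.find_spec (hex ω)
    have h2 : (⨅ k, f k ω) ≤ ‖M ω * Q' - N ω‖ := by
      have hcl : IsClosed {R : orthogonalGroup (Fin q) ℝ |
          (⨅ k, f k ω) ≤ ‖M ω * (R : Matrix (Fin q) (Fin q) ℝ) - N ω‖} := by
        have hc : Continuous fun R : orthogonalGroup (Fin q) ℝ =>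
          M ω * (R : Matrix (Fin q) (Fin q) ℝ) - N ω := by fun_prop
        exact isClosed_le continuous_const hc.norm
      exact hD.induction_on (p := fun R : orthogonalGroup (Fin q) ℝ =>
        (⨅ k, f k ω) ≤ ‖M ω * (R : Matrix (Fin q) (Fin q) ℝ) - N ω‖) ⟨Q', hQ'⟩ hcl
        fun k => ciInf_le (hbdd ω) k
    change f (Nat.find (hex ω)) ω ≤ _
    linarith

/-- The exceptional sets need not be measurable, since only monotonicity of μ is used. This matters
for the event about the penalty gradient, which is not assumed measurable. -/
theorem tendstoInMeasure_zero_of_forall {E : Type*} [SeminormedAddCommGroup E] {μ : Measure Ω}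
    {f : ℕ → Ω → E}
    (h : ∀ ε : ℝ, 0 < ε → ∃ B : ℕ → Set Ω, Tendsto (fun n => μ (B n)) atTop (𝓝 0) ∧
      ∀ᶠ n in atTop, ∀ ω, ω ∉ B n → ‖f n ω‖ < ε) :
    TendstoInMeasure μ f atTop fun _ => 0 := by
  rw [tendstoInMeasure_iff_norm]
  intro ε hε
  obtain ⟨B, hB, hev⟩ := h ε hε
  refine tendsto_of_tendsto_of_tendsto_of_le_of_le' tendsto_const_nhds hB
    (Eventually.of_forall fun _ => zero_le) ?_
  filter_upwards [hev] with n hn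
  refine measure_mono fun ω (hω : ε ≤ ‖f n ω - 0‖) => ?_
  by_contra hB
  rw [sub_zero] at hω
  exact absurd (hn ω hB) (not_lt.2 hω)

theorem eventually_sqrt_mul_inv_lt {ε : ℝ} (hε : 0 < ε) :
    ∀ᶠ n : ℕ in atTop, Real.sqrt n * (1 / ((n : ℝ) + 1)) < ε := by
  have h : Tendsto (fun n : ℕ => (Real.sqrt n)⁻¹) atTop (𝓝 0) :=
    (Real.tendsto_sqrt_atTop.comp tendsto_natCast_atTop_atTop).inv_tendsto_atTop
  filter_upwards [h.eventually_lt_const hε, eventually_gt_atTop 0] with n hn hn0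
  refine lt_of_le_of_lt ?_ hn
  have hn' : (0 : ℝ) < n := by exact_mod_cast hn0
  have hs : 0 < Real.sqrt n := Real.sqrt_pos.2 hn'
  rw [mul_one_div, div_le_iff₀ (by positivity), inv_mul_eq_div, le_div_iff₀ hs,
    Real.mul_self_sqrt hn'.le]
  linarith

/-- Both the consistency of the penalised estimates and their equivalence with the ML estimates,
in rotations that are nearly optimal. -/
theorem exists_forall_notMem_lt {μ : Measure Ω} {S : ℕ → Ω → Matrix (Fin p) (Fin p) ℝ}
    (hS : ∀ n ω, (S n ω).IsHermitian) {θ₀ : Param p q} (hθ₀ : θ₀ ∈ paramSpace p q)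
    (hcons : TendstoInMeasure μ S atTop (fun _ => modelCov θ₀))
    (hident : StronglyIdentifiable θ₀) (hjac : JacobianNonsingular θ₀)
    (hkano : KanoCondition θ₀) {P : ℕ → Ω → Param p q → ℝ} (hP : SoftPenalty μ θ₀ P)
    (hexist : Tendsto (fun n => μ {ω | ¬ (mplEstimates n (S n ω) (P n ω)).Nonempty}) atTop (𝓝 0))
    {θt θh : ℕ → Ω → Param p q}
    (hθt : ∀ n ω, (mplEstimates n (S n ω) (P n ω)).Nonempty →
      θt n ω ∈ mplEstimates n (S n ω) (P n ω))
    (hθh : ∀ n ω, (mlEstimates (q := q) n (S n ω)).Nonempty → θh n ω ∈ mlEstimates n (S n ω))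
    {Q₁ Q₂ : ℕ → Ω → Matrix (Fin q) (Fin q) ℝ}
    (hQ₂ : ∀ n ω, Q₂ n ω ∈ orthogonalGroup (Fin q) ℝ)
    (hQ₁_le : ∀ (n : ℕ) ω, ∀ Q ∈ orthogonalGroup (Fin q) ℝ,
      ‖loadings (θt n ω) * Q₁ n ω - loadings (θh n ω) * Q₂ n ω‖ ≤
        ‖loadings (θt n ω) * Q - loadings (θh n ω) * Q₂ n ω‖ + 1 / ((n : ℝ) + 1))
    (hQ₂_le : ∀ (n : ℕ) ω, ∀ Q ∈ orthogonalGroup (Fin q) ℝ,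
      ‖loadings (θh n ω) * Q₂ n ω - loadings θ₀‖ ≤
        ‖loadings (θh n ω) * Q - loadings θ₀‖ + 1 / ((n : ℝ) + 1))
    {ε : ℝ} (hε : 0 < ε) :
    ∃ B : ℕ → Set Ω, Tendsto (fun n => μ (B n)) atTop (𝓝 0) ∧ ∀ᶠ n : ℕ in atTop, ∀ ω, ω ∉ B n →
      ‖loadings (θt n ω) * Q₁ n ω - loadings θ₀‖ < ε ∧
      ‖errorCov (θt n ω) - errorCov θ₀‖ < ε ∧
      Real.sqrt n * ‖loadings (θt n ω) * Q₁ n ω - loadings (θh n ω) * Q₂ n ω‖ < ε ∧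
      Real.sqrt n * ‖errorCov (θt n ω) - errorCov (θh n ω)‖ < ε := by
  obtain ⟨U, hU, hderiv⟩ := hP.order_deriv
  obtain ⟨C, hC, hrot⟩ := exists_rotations hθ₀ hident hjac hkano hU
  obtain ⟨δ, hδ, hδrot⟩ := hrot (ε / 4) (by positivity)
  -- A gradient bound K = η√n gives a scaled distance of at most Cη, and passing to the selected
  -- rotations multiplies it by `q`; both must stay below ε/4.
  set η := ε / 4 / (C * (q + 1)) with hη
  have hη0 : 0 < η := by positivity
  have hCη : C * η * (q + 1) = ε / 4 := by rw [hη]; field_simp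
  have hCη' : C * η ≤ ε / 4 := by
    rw [← hCη]
    exact le_mul_of_one_le_right (by positivity) (by linarith [Nat.cast_nonneg (α := ℝ) q])
  set B₁ : ℕ → Set Ω := fun n => {ω | δ ≤ ‖S n ω - modelCov θ₀‖}
  set B₂ : ℕ → Set Ω := fun n => {ω | δ ≤ ‖P n ω θ₀ / Real.sqrt n - 0‖}
  set B₃ : ℕ → Set Ω := fun n => {ω | ¬ (mplEstimates n (S n ω) (P n ω)).Nonempty}
  set B₄ : ℕ → Set Ω := fun n => {ω | ∃ θ ∈ U, η * Real.sqrt n < ‖fderiv ℝ (P n ω) θ‖}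
  have h₁ : Tendsto (fun n => μ (B₁ n)) atTop (𝓝 0) := tendstoInMeasure_iff_norm.1 hcons δ hδ
  have h₂ : Tendsto (fun n => μ (B₂ n)) atTop (𝓝 0) :=
    tendstoInMeasure_iff_norm.1 (hP.order θ₀ hθ₀) δ hδ
  have h₄ : Tendsto (fun n => μ (B₄ n)) atTop (𝓝 0) := hderiv η hη0
  refine ⟨fun n => B₁ n ∪ B₂ n ∪ (B₃ n ∪ B₄ n), ?_, ?_⟩
  · have h := (h₁.add h₂).add (hexist.add h₄)
    simp only [add_zero] at h
    refine tendsto_of_tendsto_of_tendsto_of_le_of_le tendsto_const_nhds h (fun _ => zero_le)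
      fun n => ?_
    exact (measure_union_le _ _).trans (add_le_add (measure_union_le _ _) (measure_union_le _ _))
  · filter_upwards [eventually_sqrt_mul_inv_lt (ε := ε / 8) (by positivity),
      eventually_gt_atTop 0] with n hn8 hn ω hω
    simp only [Set.mem_union, not_or, B₁, B₂, B₃, B₄, Set.mem_ofPred_eq, not_le, not_not,
      not_exists, not_and, not_lt, sub_zero, Real.norm_eq_abs] at hω
    obtain ⟨⟨hω1, hω2⟩, hω3, hω4⟩ := hω
    have hn' : (0 : ℝ) < n := by exact_mod_cast hn
    have hs1 : (1 : ℝ) ≤ Real.sqrt n := by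
      rw [Real.one_le_sqrt]; exact_mod_cast hn
    have hss : Real.sqrt n * Real.sqrt n = n := Real.mul_self_sqrt hn'.le
    obtain ⟨hml, hmain⟩ := hδrot (S n ω) (hS n ω) hω1 n hn (P n ω) (hP.nonpos n ω)
      (hP.contDiffOn n ω) (hP.rotate_eq n ω) hω2 (η * Real.sqrt n) (by positivity) hω4
    obtain ⟨R₁, hR₁, R₂, hR₂, ht, hh, hd⟩ := hmain _ (hθt n ω hω3) _ (hθh n ω hml)
    have hd' : Real.sqrt n * ‖rotate (θt n ω) R₁ - rotate (θh n ω) R₂‖ ≤ C * η := by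
      calc Real.sqrt n * ‖rotate (θt n ω) R₁ - rotate (θh n ω) R₂‖
          ≤ Real.sqrt n * (C * (η * Real.sqrt n) / n) := by gcongr
        _ = C * η * (Real.sqrt n * Real.sqrt n) / n := by ring
        _ = C * η := by rw [hss]; field_simp
    rw [norm_param, loadings_sub, errorCov_sub, loadings_rotate, errorCov_rotate] at ht hh hd'
    rw [loadings_rotate, errorCov_rotate] at hd'
    rw [max_lt_iff] at ht hh
    have hd1 : Real.sqrt n * ‖loadings (θt n ω) * R₁ - loadings (θh n ω) * R₂‖ ≤ C * η :=
      le_trans (by gcongr; exact le_max_left _ _) hd'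
    have hd2 : Real.sqrt n * ‖errorCov (θt n ω) - errorCov (θh n ω)‖ ≤ C * η :=
      le_trans (by gcongr; exact le_max_right _ _) hd'
    -- The competitor for `Q₁` is R₁R₂ᵀQ₂: it carries the aligned pair into the frame in which the
    -- ML loadings are rotated by `Q₂`.
    have hR₂t : star R₂ ∈ orthogonalGroup (Fin q) ℝ := Unitary.star_mem hR₂
    have hT := (orthogonalGroup (Fin q) ℝ).mul_mem hR₂t (hQ₂ n ω)
    have hTeq : loadings (θt n ω) * (R₁ * (star R₂ * Q₂ n ω)) - loadings (θh n ω) * Q₂ n ω =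
        (loadings (θt n ω) * R₁ - loadings (θh n ω) * R₂) * (star R₂ * Q₂ n ω) := by
      have e : R₂ * star R₂ = 1 := (mem_unitaryGroup_iff).1 hR₂
      rw [Matrix.sub_mul, Matrix.mul_assoc, Matrix.mul_assoc, ← Matrix.mul_assoc R₂, e,
        Matrix.one_mul]
    have hb1 := hQ₁_le n ω _ ((orthogonalGroup (Fin q) ℝ).mul_mem hR₁ hT)
    rw [hTeq] at hb1
    have hb2 := norm_mul_orthogonal_le
      (loadings (θt n ω) * R₁ - loadings (θh n ω) * R₂) hT
    have hb : Real.sqrt n * ‖loadings (θt n ω) * Q₁ n ω - loadings (θh n ω) * Q₂ n ω‖ <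
        ε / 4 + ε / 8 := by
      calc Real.sqrt n * ‖loadings (θt n ω) * Q₁ n ω - loadings (θh n ω) * Q₂ n ω‖
          ≤ Real.sqrt n * (q * ‖loadings (θt n ω) * R₁ - loadings (θh n ω) * R₂‖ +
              1 / ((n : ℝ) + 1)) := by gcongr; linarith
        _ = q * (Real.sqrt n * ‖loadings (θt n ω) * R₁ - loadings (θh n ω) * R₂‖) +
              Real.sqrt n * (1 / ((n : ℝ) + 1)) := by ring
        _ ≤ q * (C * η) + Real.sqrt n * (1 / ((n : ℝ) + 1)) := by gcongr
        _ < ε / 4 + ε / 8 := by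
            have : 0 < C * η := by positivity
            linarith
    have hb' : ‖loadings (θt n ω) * Q₁ n ω - loadings (θh n ω) * Q₂ n ω‖ < ε / 4 + ε / 8 :=
      lt_of_le_of_lt (le_mul_of_one_le_left (norm_nonneg _) hs1) hb
    have ha := hQ₂_le n ω R₂ hR₂
    have hn8' : 1 / ((n : ℝ) + 1) < ε / 8 :=
      lt_of_le_of_lt (le_mul_of_one_le_left (by positivity) hs1) hn8
    refine ⟨?_, by linarith [ht.2], by linarith, by linarith⟩
    -- Each of the two legs is less than ε/4 + ε/8, so the sum stays below ε.
    have htri := norm_sub_le_norm_sub_add_norm_sub (loadings (θt n ω) * Q₁ n ω)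
      (loadings (θh n ω) * Q₂ n ω) (loadings θ₀)
    linarith [hh.1]

theorem measurable_scaledError_rotate (n : ℕ) (θ₀ : Param p q) {θ : Ω → Param p q}
    (hθ : Measurable θ) {Q : Ω → Matrix (Fin q) (Fin q) ℝ} (hQ : MeasurableEntries Q) :
    Measurable fun ω => scaledError n θ₀ (rotate (θ ω) (Q ω)) := by
  have h : Measurable fun ω => rotate (θ ω) (Q ω) :=
    (measurable_pi_iff.2 fun i => measurable_pi_iff.2 fun j =>
      ((measurableEntries_loadings hθ).mul hQ) i j).prodMk (measurable_snd.comp hθ)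
  exact (h.sub_const θ₀).const_smul (Real.sqrt n)

theorem norm_scaledError_sub_le (n : ℕ) (θ₀ θ θ' : Param p q)
    {Q Q' R : Matrix (Fin q) (Fin q) ℝ} (hR : R ∈ orthogonalGroup (Fin q) ℝ) :
    ‖scaledError n θ₀ (rotate θ (Q * R)) - scaledError n θ₀ (rotate θ' (Q' * R))‖ ≤
      q * (Real.sqrt n * ‖loadings θ * Q - loadings θ' * Q'‖) +
        Real.sqrt n * ‖errorCov θ - errorCov θ'‖ := by
  rw [scaledError, scaledError, ← smul_sub, sub_sub_sub_cancel_right, norm_smul,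
    Real.norm_eq_abs, abs_of_nonneg (Real.sqrt_nonneg _), norm_param, loadings_sub, errorCov_sub,
    loadings_rotate, loadings_rotate, errorCov_rotate, errorCov_rotate, ← Matrix.mul_assoc,
    ← Matrix.mul_assoc, ← Matrix.sub_mul]
  have h := norm_mul_orthogonal_le (loadings θ * Q - loadings θ' * Q') hR
  have h1 : max ‖(loadings θ * Q - loadings θ' * Q') * R‖ ‖errorCov θ - errorCov θ'‖ ≤
      q * ‖loadings θ * Q - loadings θ' * Q'‖ + ‖errorCov θ - errorCov θ'‖ :=
    max_le (by linarith [norm_nonneg (errorCov θ - errorCov θ')])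
      (by linarith [(norm_nonneg _).trans h])
  refine (mul_le_mul_of_nonneg_left h1 (Real.sqrt_nonneg n)).trans_eq (by ring)

end Asymptotics

end FactorAnalysis

theorem theorem3 {p q : ℕ} (hqp : q < p)
    {Ω : Type*} [MeasurableSpace Ω] (μ : Measure Ω) [IsProbabilityMeasure μ]
    -- for each `n`, a sample of `n` random vectors, with sample covariance matrix `S n`
    (x : (n : ℕ) → Fin n → Ω → Fin p → ℝ) (hx : ∀ n i, Measurable (x n i))
    (S : ℕ → Ω → Matrix (Fin p) (Fin p) ℝ)
    (hS : ∀ n ω, S n ω = FactorAnalysis.sampleCov (fun i => x n i ω))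
    (θ₀ : FactorAnalysis.Param p q) (hθ₀ : θ₀ ∈ interior (FactorAnalysis.paramSpace p q))
    (hcons : TendstoInMeasure μ S atTop (fun _ => FactorAnalysis.modelCov θ₀))
    (hident : FactorAnalysis.StronglyIdentifiable θ₀)
    (hjac : FactorAnalysis.JacobianNonsingular θ₀)
    (hkano : FactorAnalysis.KanoCondition θ₀)
    (P : ℕ → Ω → FactorAnalysis.Param p q → ℝ)
    (hP : FactorAnalysis.SoftPenalty μ θ₀ P)
    -- penalised estimates exist with probability tending to one
    (hexist : Tendsto
      (fun n => μ {ω | ¬ (FactorAnalysis.mplEstimates n (S n ω) (P n ω)).Nonempty}) atTop (𝓝 0))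
    -- `θt` is any selection of penalised estimates and `θh` any selection of ML estimates
    (θt θh : ℕ → Ω → FactorAnalysis.Param p q)
    (hθt_meas : ∀ n, Measurable (θt n)) (hθh_meas : ∀ n, Measurable (θh n))
    (hθt : ∀ n ω, (FactorAnalysis.mplEstimates n (S n ω) (P n ω)).Nonempty →
      θt n ω ∈ FactorAnalysis.mplEstimates n (S n ω) (P n ω))
    (hθh : ∀ n ω, (FactorAnalysis.mlEstimates (q := q) n (S n ω)).Nonempty →
      θh n ω ∈ FactorAnalysis.mlEstimates n (S n ω)) :
    ∃ Q₁ Q₂ : ℕ → Ω → Matrix (Fin q) (Fin q) ℝ,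
      (∀ n, FactorAnalysis.MeasurableEntries (Q₁ n)) ∧ (∀ n, FactorAnalysis.MeasurableEntries (Q₂ n)) ∧
      (∀ n ω, Q₁ n ω ∈ Matrix.orthogonalGroup (Fin q) ℝ) ∧
      (∀ n ω, Q₂ n ω ∈ Matrix.orthogonalGroup (Fin q) ℝ) ∧
      -- consistency
      TendstoInMeasure μ (fun n ω => ‖FactorAnalysis.loadings (θt n ω) * Q₁ n ω -
        FactorAnalysis.loadings θ₀‖) atTop (fun _ => (0 : ℝ)) ∧
      TendstoInMeasure μ (fun n ω => ‖FactorAnalysis.errorCov (θt n ω) -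
        FactorAnalysis.errorCov θ₀‖) atTop (fun _ => (0 : ℝ)) ∧
      -- equivalence with the ML estimates at the rate `√n`
      TendstoInMeasure μ (fun (n : ℕ) ω => Real.sqrt n * ‖FactorAnalysis.loadings (θt n ω) * Q₁ n ω -
        FactorAnalysis.loadings (θh n ω) * Q₂ n ω‖) atTop (fun _ => (0 : ℝ)) ∧
      TendstoInMeasure μ (fun (n : ℕ) ω => Real.sqrt n * ‖FactorAnalysis.errorCov (θt n ω) -
        FactorAnalysis.errorCov (θh n ω)‖) atTop (fun _ => (0 : ℝ)) ∧
      -- a limit law of the ML estimates, in whatever rotation, is a limit law of the penalised ones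
      ∀ R : ℕ → Ω → Matrix (Fin q) (Fin q) ℝ, (∀ n, FactorAnalysis.MeasurableEntries (R n)) →
        (∀ n ω, R n ω ∈ Matrix.orthogonalGroup (Fin q) ℝ) →
        ∀ (ν : Measure (FactorAnalysis.Param p q)) [IsProbabilityMeasure ν],
          TendstoInDistribution (fun n ω => FactorAnalysis.scaledError n θ₀
            (FactorAnalysis.rotate (θh n ω) (Q₂ n ω * R n ω))) atTop id (fun _ => μ) ν →
          TendstoInDistribution (fun n ω => FactorAnalysis.scaledError n θ₀
            (FactorAnalysis.rotate (θt n ω) (Q₁ n ω * R n ω))) atTop id (fun _ => μ) ν := by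
  have hθ₀' : θ₀ ∈ FactorAnalysis.paramSpace p q := interior_subset hθ₀
  have hSh : ∀ n ω, (S n ω).IsHermitian := fun n ω => by
    rw [hS]
    exact FactorAnalysis.isHermitian_sampleCov _
  -- The order matters: `Q₂` turns the ML loadings towards Λ₀, and `Q₁` then turns the penalised
  -- loadings towards the rotated ML loadings, not towards Λ₀.
  choose Q₂ hQ₂m hQ₂ hQ₂_le using fun n : ℕ =>
    FactorAnalysis.exists_measurable_rotation
      (FactorAnalysis.measurableEntries_loadings (hθh_meas n))
      (FactorAnalysis.measurableEntries_const (FactorAnalysis.loadings θ₀))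
      (ε := 1 / ((n : ℝ) + 1)) (by positivity)
  choose Q₁ hQ₁m hQ₁ hQ₁_le using fun n : ℕ =>
    FactorAnalysis.exists_measurable_rotation
      (FactorAnalysis.measurableEntries_loadings (hθt_meas n))
      ((FactorAnalysis.measurableEntries_loadings (hθh_meas n)).mul (hQ₂m n))
      (ε := 1 / ((n : ℝ) + 1)) (by positivity)
  have key := fun (ε : ℝ) (hε : 0 < ε) =>
    FactorAnalysis.exists_forall_notMem_lt hSh hθ₀' hcons hident hjac hkano hP hexist hθt hθh
      hQ₂ hQ₁_le hQ₂_le hε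
  refine ⟨Q₁, Q₂, hQ₁m, hQ₂m, hQ₁, hQ₂, ?_, ?_, ?_, ?_, ?_⟩
  · refine FactorAnalysis.tendstoInMeasure_zero_of_forall fun ε hε => ?_
    obtain ⟨B, hB, hev⟩ := key ε hε
    refine ⟨B, hB, hev.mono fun n hn ω hω => ?_⟩
    rw [norm_norm]
    exact (hn ω hω).1
  · refine FactorAnalysis.tendstoInMeasure_zero_of_forall fun ε hε => ?_
    obtain ⟨B, hB, hev⟩ := key ε hε
    refine ⟨B, hB, hev.mono fun n hn ω hω => ?_⟩
    rw [norm_norm]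
    exact (hn ω hω).2.1
  · refine FactorAnalysis.tendstoInMeasure_zero_of_forall fun ε hε => ?_
    obtain ⟨B, hB, hev⟩ := key ε hε
    refine ⟨B, hB, hev.mono fun n hn ω hω => ?_⟩
    rw [Real.norm_of_nonneg (by positivity)]
    exact (hn ω hω).2.2.1
  · refine FactorAnalysis.tendstoInMeasure_zero_of_forall fun ε hε => ?_
    obtain ⟨B, hB, hev⟩ := key ε hε
    refine ⟨B, hB, hev.mono fun n hn ω hω => ?_⟩
    rw [Real.norm_of_nonneg (by positivity)]
    exact (hn ω hω).2.2.2
  · intro R hRm hR ν _ hlim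
    -- Slutsky's lemma. The common rotation `R` costs a factor `q` on the loadings, hence the
    -- tolerance ε/(q + 1) below.
    refine tendstoInDistribution_of_tendstoInMeasure_sub _ id hlim ?_ fun n =>
      (FactorAnalysis.measurable_scaledError_rotate n θ₀ (hθt_meas n)
        ((hQ₁m n).mul (hRm n))).aemeasurable
    refine FactorAnalysis.tendstoInMeasure_zero_of_forall fun ε hε => ?_
    obtain ⟨B, hB, hev⟩ := key (ε / (q + 1)) (by positivity)
    refine ⟨B, hB, hev.mono fun n hn ω hω => ?_⟩
    obtain ⟨-, -, h1, h2⟩ := hn ω hω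
    refine (FactorAnalysis.norm_scaledError_sub_le n θ₀ (θt n ω) (θh n ω) (hR n ω)).trans_lt ?_
    calc _ ≤ q * (ε / (q + 1)) + Real.sqrt n *
          ‖FactorAnalysis.errorCov (θt n ω) - FactorAnalysis.errorCov (θh n ω)‖ := by gcongr
      _ < q * (ε / (q + 1)) + ε / (q + 1) := by gcongr
      _ = ε := by field_simp
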